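/- Let $\mathrm{Ai},\mathrm{Bi}$ be the Airy functions and let $u$ be the Hastings–McLeod solution of Painlevé II, i.e. the real solution of $u''=tu+2u^3$ on $\mathbb R$ with $u(t)\sim\mathrm{Ai}(t)$ as $t\to+\infty$. Consider the linear system $$\phi_1'=-\tfrac23\phi_2,\qquad \phi_2'=-\tfrac23u\,\phi_0-\tfrac16(t+2u^2)\phi_1,\qquad \phi_0'=\tfrac13u'\phi_1-\tfrac23u\,\phi_2.\tag{1}$$ Put $g_1(t)=\mathrm{Bi}(t/3^{2/3})$, $g_2(t)=\mathrm{Ai}(t/3^{2/3})$, $g_0(t)=0$, $\delta_k=1$ if $k=0$ and $\delta_k=0$ if $k=1,2$. For a triple $(\phi_1,\phi_2,\phi_0)$ put $S[\phi]=-\tfrac23u\,\phi_0-\tfrac13u^2\phi_1$ and $$A[\phi](t)=\int_\infty^t\mathrm{Ai}(s/3^{2/3})\,S[\phi](s)\,ds,\qquad B[\phi](t)=\int_\infty^t\mathrm{Bi}(s/3^{2/3})\,S[\phi](s)\,ds.$$ For $k=1,2,0$ define the iterates by $\Phi_{1k}^{(0)}=(1-\delta_k)g_k$, $\Phi_{2k}^{(0)}=-\tfrac32(1-\delta_k)g_k'$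 and, for $j\ge0$, with $\Phi_{\cdot k}^{(j)}=(\Phi_{1k}^{(j)},\Phi_{2k}^{(j)},\Phi_{0k}^{(j)})$, $$\Phi_{1k}^{(j+1)}(t)=g_k(t)+\tfrac{2\pi}{3^{1/3}}\Big[\mathrm{Ai}(\tfrac t{3^{2/3}})\,B[\Phi_{\cdot k}^{(j)}](t)-\mathrm{Bi}(\tfrac t{3^{2/3}})\,A[\Phi_{\cdot k}^{(j)}](t)\Big],$$ $$\Phi_{2k}^{(j+1)}(t)=-\tfrac32g_k'(t)-\pi\Big[\mathrm{Ai}'(\tfrac t{3^{2/3}})\,B[\Phi_{\cdot k}^{(j)}](t)-\mathrm{Bi}'(\tfrac t{3^{2/3}})\,A[\Phi_{\cdot k}^{(j)}](t)\Big],$$ and, for all $j\ge0$, $$\Phi_{0k}^{(j)}(t)=\delta_k+\int_\infty^t\Big(\tfrac13u'(s)\Phi_{1k}^{(j)}(s)-\tfrac23u(s)\Phi_{2k}^{(j)}(s)\Big)ds .$$ Call $t_0^P\ge1$ a *threshold* if $$|\mathrm{Bi}(x)|<e^{\frac23x^{3/2}},\quad|\mathrm{Bi}'(x)|<\sqrt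 x\,e^{\frac23x^{3/2}},\quad|\mathrm{Ai}(x)|<e^{-\frac23x^{3/2}},\quad|\mathrm{Ai}'(x)|<\sqrt x\,e^{-\frac23x^{3/2}}\qquad(x\ge t_0^P/3^{2/3}),$$ $$|u(x)|<e^{-\frac23x^{3/2}},\quad|u'(x)|<\sqrt x\,e^{-\frac23x^{3/2}}\qquad(x\ge t_0^P).$$ **Theorem.** Thresholds exist, and for every threshold $t_0^P$ the following holds. 1. All integrals in the definition of the iterates converge absolutely for $t\ge t_0^P$. 2. For $k=1,2,0$, $j\ge0$ and $t\ge t_0^P$, $$|\Phi_{1k}^{(j+1)}-\Phi_{1k}^{(j)}|(t)<C_{1k}^{(j+1)}e^{-(\frac43j+\frac49k+\frac23)t^{3/2}},\qquad|\Phi_{2k}^{(j+1)}-\Phi_{2k}^{(j)}|(t)<C_{2k}^{(j+1)}t^{1/2}e^{-(\frac43j+\frac49k+\frac23)t^{3/2}},$$ $$|\Phi_{0k}^{(j+1)}-\Phi_{0k}^{(j)}|(t)<C_{0k}^{(j+1)}e^{-(\frac43j+\frac49k+\frac43)t^{3/2}},$$ where, for $j\ge1$, $C_{2k}^{(j)}=\frac12C_{1k}^{(j)}$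 and $$C_{11}^{(j)}=\pi^j3^{-j/3}\prod_{i=1}^j\tfrac{6i-1}{(3i-1)(3i-2)},\qquad C_{01}^{(j)}=\pi^j3^{-j/3}\prod_{i=1}^j\tfrac{6i-1}{(3i-1)(3i+1)},$$ $$C_{12}^{(j)}=\pi^j3^{-j/3}\prod_{i=1}^j\tfrac{6i+1}{3i(3i-1)},\qquad C_{02}^{(j)}=\tfrac12\pi^j3^{-j/3}\prod_{i=1}^j\tfrac{6i+1}{3i(3i+2)},$$ $$C_{10}^{(j)}=\tfrac{3\pi^j3^{-j/3}}{(j-1)!}\prod_{i=1}^j\tfrac{2i-1}{3i-2},\qquad C_{00}^{(j)}=\tfrac{\pi^j3^{-j/3}}{j!}\prod_{i=1}^j\tfrac{2i-1}{3i-2}.$$ 3. For $k=1,2,0$ and every $t\ge t_0^P$, the limits $\Phi_{ik}(t)=\lim_{j\to\infty}\Phi_{ik}^{(j)}(t)$, $i=1,2,0$, exist. On $[t_0^P,\infty)$ each triple $(\Phi_{1k},\Phi_{2k},\Phi_{0k})$ solves the integral equations obtained by dropping the superscripts $(j)$, $(j+1)$ in the recursion (with absolutely convergent integrals) and solves the linear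 system (1). The three triples are linearly independent on $[t_0^P,\infty)$. -/

import Mathlib

open MeasureTheory Filter Topology

namespace AiryPicard

noncomputable section

/-- The Airy function `Ai` on the real line, as the absolutely convergent contour integral
`(2πi)⁻¹ ∫ exp (z³/3 - x z) dz` from `∞ e^{-iπ/3}` through `0` to `∞ e^{iπ/3}`, written out in
real form on the two rays `z = r e^{±iπ/3}`, on which `z³ = -r³`. It is entire in `x` and agrees
with the improper integral `π⁻¹ ∫₀^∞ cos (r³/3 + x r) dr` for real `x`. -/
def Ai (x : ℝ) : ℝ :=
  Real.pi⁻¹ * ∫ r in Set.Ioi (0 : ℝ),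
    Real.exp (-r ^ 3 / 3 - x * r / 2) * Real.cos (Real.sqrt 3 / 2 * (x * r) + Real.pi / 6)

/-- The Airy function `Bi` on the real line, as the absolutely convergent contour integral
`(2π)⁻¹ (∫_{-∞}^{∞ e^{iπ/3}} + ∫_{-∞}^{∞ e^{-iπ/3}}) exp (z³/3 - x z) dz`, written out in real form
on the rays `z = -r` and `z = r e^{±iπ/3}`. It agrees with the improper integral
`π⁻¹ ∫₀^∞ (exp (-r³/3 + x r) + sin (r³/3 + x r)) dr` for real `x`. -/
def Bi (x : ℝ) : ℝ :=
  Real.pi⁻¹ * ∫ r in Set.Ioi (0 : ℝ),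
    (Real.exp (-r ^ 3 / 3 + x * r) +
      Real.exp (-r ^ 3 / 3 - x * r / 2) * Real.sin (Real.sqrt 3 / 2 * (x * r) + Real.pi / 6))

/-- `u` is the Hastings–McLeod solution of Painlevé II: the real solution of
`u'' = t u + 2 u³` on the whole line with `u(t) ~ Ai(t)` as `t → +∞` (which determines it). -/
structure IsHastingsMcLeod (u : ℝ → ℝ) : Prop where
  differentiable : Differentiable ℝ u
  painleve : ∀ t : ℝ, HasDerivAt (deriv u) (t * u t + 2 * u t ^ 3) t
  asymp : Asymptotics.IsEquivalent atTop u Ai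

/-- `T` is a possible value of the threshold `t₀ᴾ`: the exponential estimates hold for
`Ai, Ai', Bi, Bi'` at `x` and at `x / 3^{2/3}`, and for `u, u'` at `x`, for all `x ≥ T`;
moreover `T ≥ 1`. -/
structure IsThreshold (u : ℝ → ℝ) (T : ℝ) : Prop where
  one_le : 1 ≤ T
  bi : ∀ x : ℝ, T / (3 : ℝ) ^ (2 / 3 : ℝ) ≤ x →
    |Bi x| < Real.exp (2 / 3 * x ^ (3 / 2 : ℝ)) ∧
    |deriv Bi x| < Real.exp (2 / 3 * x ^ (3 / 2 : ℝ)) * Real.sqrt x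
  ai : ∀ x : ℝ, T / (3 : ℝ) ^ (2 / 3 : ℝ) ≤ x →
    |Ai x| < Real.exp (-(2 / 3 * x ^ (3 / 2 : ℝ))) ∧
    |deriv Ai x| < Real.exp (-(2 / 3 * x ^ (3 / 2 : ℝ))) * Real.sqrt x
  hm : ∀ x : ℝ, T ≤ x →
    |u x| < Real.exp (-(2 / 3 * x ^ (3 / 2 : ℝ))) ∧
    |deriv u x| < Real.exp (-(2 / 3 * x ^ (3 / 2 : ℝ))) * Real.sqrt x

/-- `∫_∞^t f(s) ds = -∫_t^∞ f(s) ds`. -/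
def intFromInfty (f : ℝ → ℝ) (t : ℝ) : ℝ := -∫ s in Set.Ioi t, f s

/-- `s / 3^{2/3}`. -/
def sc (s : ℝ) : ℝ := s / (3 : ℝ) ^ (2 / 3 : ℝ)

/-- `g₁(t) = Bi(t/3^{2/3})`, `g₂(t) = Ai(t/3^{2/3})`, `g₀(t) = 0`. -/
def g : Fin 3 → ℝ → ℝ :=
  ![fun _ => 0, fun t => Bi (sc t), fun t => Ai (sc t)]

/-- The Kronecker symbol `δ_k^0`. -/
def delta (k : Fin 3) : ℝ := if k = 0 then 1 else 0

/-! A triple `(φ₁, φ₂, φ₀)` of functions is a map `φ : Fin 3 → ℝ → ℝ`; `φ i` is `φ_i`. -/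

/-- The linear system
`φ₁' = -(2/3) φ₂`, `φ₂' = -(2/3) u φ₀ - (1/6) (t + 2 u²) φ₁`, `φ₀' = (1/3) u' φ₁ - (2/3) u φ₂`
on `[T, ∞)` (one-sided derivatives at `T`). -/
def IsSolutionOn (u : ℝ → ℝ) (T : ℝ) (φ : Fin 3 → ℝ → ℝ) : Prop :=
  ∀ t : ℝ, T ≤ t →
    HasDerivWithinAt (φ 1) (-(2 / 3) * φ 2 t) (Set.Ici T) t ∧
    HasDerivWithinAt (φ 2) (-(2 / 3) * u t * φ 0 t - 1 / 6 * (t + 2 * u t ^ 2) * φ 1 t)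
      (Set.Ici T) t ∧
    HasDerivWithinAt (φ 0) (1 / 3 * deriv u t * φ 1 t - 2 / 3 * u t * φ 2 t) (Set.Ici T) t

/-- `-(2/3) u(s) φ₀(s) - (1/3) u(s)² φ₁(s)`. -/
def source (u : ℝ → ℝ) (φ : Fin 3 → ℝ → ℝ) (s : ℝ) : ℝ :=
  -(2 / 3) * u s * φ 0 s - 1 / 3 * u s ^ 2 * φ 1 s

/-- Right-hand side of the integral equation for `Φ_{1k}`. -/
def rhsOne (u : ℝ → ℝ) (k : Fin 3) (φ : Fin 3 → ℝ → ℝ) (t : ℝ) : ℝ :=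
  g k t + 2 * Real.pi / (3 : ℝ) ^ (1 / 3 : ℝ) *
    (Ai (sc t) * intFromInfty (fun s => Bi (sc s) * source u φ s) t -
      Bi (sc t) * intFromInfty (fun s => Ai (sc s) * source u φ s) t)

/-- Right-hand side of the integral equation for `Φ_{2k}`. -/
def rhsTwo (u : ℝ → ℝ) (k : Fin 3) (φ : Fin 3 → ℝ → ℝ) (t : ℝ) : ℝ :=
  -(3 / 2) * deriv (g k) t - Real.pi *
    (deriv Ai (sc t) * intFromInfty (fun s => Bi (sc s) * source u φ s) t -
      deriv Bi (sc t) * intFromInfty (fun s => Ai (sc s) * source u φ s) t)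

/-- Right-hand side of the integral equation for `Φ_{0k}`. -/
def rhsZero (u : ℝ → ℝ) (k : Fin 3) (φ₁ φ₂ : ℝ → ℝ) (t : ℝ) : ℝ :=
  delta k + intFromInfty (fun s => 1 / 3 * deriv u s * φ₁ s - 2 / 3 * u s * φ₂ s) t

/-- All integrals in the three right-hand sides converge absolutely for `t ≥ T`. -/
def IntegralsConverge (u : ℝ → ℝ) (T : ℝ) (φ : Fin 3 → ℝ → ℝ) : Prop :=
  IntegrableOn (fun s => Bi (sc s) * source u φ s) (Set.Ioi T) ∧
  IntegrableOn (fun s => Ai (sc s) * source u φ s) (Set.Ioi T) ∧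
  IntegrableOn (fun s => 1 / 3 * deriv u s * φ 1 s - 2 / 3 * u s * φ 2 s) (Set.Ioi T)

/-- `φ = (Φ_{1k}, Φ_{2k}, Φ_{0k})` solves the `k`-th system of integral equations on `[T, ∞)`. -/
def SolvesIntegralEquations (u : ℝ → ℝ) (T : ℝ) (k : Fin 3) (φ : Fin 3 → ℝ → ℝ) : Prop :=
  IntegralsConverge u T φ ∧
  ∀ t : ℝ, T ≤ t →
    φ 1 t = rhsOne u k φ t ∧ φ 2 t = rhsTwo u k φ t ∧ φ 0 t = rhsZero u k (φ 1) (φ 2) t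

/-- The Picard iterates: `iterate u k j i` is `Φ_{ik}^{(j)}`. The new `Φ_{0k}` is computed from the
new `Φ_{1k}` and `Φ_{2k}`. -/
def iterate (u : ℝ → ℝ) (k : Fin 3) : ℕ → Fin 3 → ℝ → ℝ
  | 0 =>
    let p₁ : ℝ → ℝ := fun t => (1 - delta k) * g k t
    let p₂ : ℝ → ℝ := fun t => -(3 / 2) * (1 - delta k) * deriv (g k) t
    ![rhsZero u k p₁ p₂, p₁, p₂]
  | j + 1 =>
    let p₁ : ℝ → ℝ := rhsOne u k (iterate u k j)
    let p₂ : ℝ → ℝ := rhsTwo u k (iterate u k j)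
    ![rhsZero u k p₁ p₂, p₁, p₂]

/-- The constants `C_{1k}^{(j)}`, `j ≥ 1`. -/
def C₁ (k : Fin 3) (j : ℕ) : ℝ :=
  Real.pi ^ j * (3 : ℝ) ^ (-(j : ℝ) / 3) *
    ![3 / ((j - 1).factorial : ℝ) * ∏ i ∈ Finset.Icc 1 j, (2 * (i : ℝ) - 1) / (3 * (i : ℝ) - 2),
      ∏ i ∈ Finset.Icc 1 j, (6 * (i : ℝ) - 1) / ((3 * (i : ℝ) - 1) * (3 * (i : ℝ) - 2)),
      ∏ i ∈ Finset.Icc 1 j, (6 * (i : ℝ) + 1) / (3 * (i : ℝ) * (3 * (i : ℝ) - 1))] k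

/-- The constants `C_{2k}^{(j)}`, `j ≥ 1`. -/
def C₂ (k : Fin 3) (j : ℕ) : ℝ := C₁ k j / 2

/-- The constants `C_{0k}^{(j)}`, `j ≥ 1`. -/
def C₀ (k : Fin 3) (j : ℕ) : ℝ :=
  Real.pi ^ j * (3 : ℝ) ^ (-(j : ℝ) / 3) *
    ![1 / (j.factorial : ℝ) * ∏ i ∈ Finset.Icc 1 j, (2 * (i : ℝ) - 1) / (3 * (i : ℝ) - 2),
      ∏ i ∈ Finset.Icc 1 j, (6 * (i : ℝ) - 1) / ((3 * (i : ℝ) - 1) * (3 * (i : ℝ) + 1)),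
      1 / 2 * ∏ i ∈ Finset.Icc 1 j, (6 * (i : ℝ) + 1) / (3 * (i : ℝ) * (3 * (i : ℝ) + 2))] k

/-- The explicit exponential bounds on `Φ_{ik}^{(j+1)}(t) - Φ_{ik}^{(j)}(t)`. -/
def DifferenceBounds (u : ℝ → ℝ) (k : Fin 3) (j : ℕ) (t : ℝ) : Prop :=
  |iterate u k (j + 1) 1 t - iterate u k j 1 t| <
    C₁ k (j + 1) *
      Real.exp (-(4 / 3 * (j : ℝ) + 4 / 9 * ((k : ℕ) : ℝ) + 2 / 3) * t ^ (3 / 2 : ℝ)) ∧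
  |iterate u k (j + 1) 2 t - iterate u k j 2 t| <
    C₂ k (j + 1) * Real.sqrt t *
      Real.exp (-(4 / 3 * (j : ℝ) + 4 / 9 * ((k : ℕ) : ℝ) + 2 / 3) * t ^ (3 / 2 : ℝ)) ∧
  |iterate u k (j + 1) 0 t - iterate u k j 0 t| <
    C₀ k (j + 1) *
      Real.exp (-(4 / 3 * (j : ℝ) + 4 / 9 * ((k : ℕ) : ℝ) + 4 / 3) * t ^ (3 / 2 : ℝ))

end

end AiryPicard

open AiryPicard

/-!
Variation of parameters with the Airy functions, whose Wronskian is `π⁻¹`, turns the linear system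
into the integral equations, and the homogeneous linear part `picard` of these equations maps each
difference of consecutive Picard iterates to the next one. Beyond a threshold, the factors `u` and
`u²` of the source contribute `exp (-(2/3) t^{3/2})` and `exp (-(4/3) t^{3/2})`, and integrating
`√s exp (-a s^{3/2})` from `t` to `∞` gives exactly `(2/3) a⁻¹ exp (-a t^{3/2})`. The products of
the resulting factors are the constants `C₁` and `C₀`, which are summable in `j`; so the iterates
converge under a common exponential bound, and by dominated convergence the limit solves the
integral equations. If a linear combination of the three limits vanishes, so does its image under
`picard`; hence the same combination of the inhomogeneous terms `g_k`, `-(3/2) g_k'`, `δ_k`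
vanishes, and the Wronskian makes it trivial.

Thresholds exist because `Ai` decays faster than `exp (-(2/3) x^{3/2})`: with `p = √x + 1 / (8 x)`,
a subsolution `p² ≤ x + p'` of the Riccati equation, `Ai² exp (2 ∫ p)` is nonincreasing. `Bi` is
estimated through its integral representation, `u` by comparison with `Ai`, and the derivatives
by integrating the differential equations.
-/

namespace AiryPicard

open Set Asymptotics

noncomputable section

section Moments

/-- The moments `∫₀^∞ (ωr)ⁿ exp (-r³/3 + ωxr) dr`, that is, `ω⁻¹ ∫ zⁿ exp (-z³/3 + xz) dz` along
the ray `z = ωr` when `ω³ = 1`; each is the derivative in `x` of the previous one. -/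
def airyMoment (ω : ℂ) (n : ℕ) (x : ℝ) : ℂ :=
  ∫ r in Ioi (0 : ℝ), (ω * r) ^ n * Complex.exp (-(r : ℂ) ^ 3 / 3 + ω * x * r)

theorem exp_neg_cube_add_isBigO (c : ℝ) :
    (fun r : ℝ => Real.exp (-r ^ 3 / 3 + c * r)) =O[atTop] fun r => Real.exp (-2 * r) := by
  refine IsBigO.of_bound 1 ?_
  filter_upwards [eventually_ge_atTop (|c| + 3)] with r hr
  rw [Real.norm_of_nonneg (Real.exp_nonneg _), Real.norm_of_nonneg (Real.exp_nonneg _), one_mul,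
    Real.exp_le_exp]
  have hc : c + 2 ≤ r ^ 2 / 3 := by nlinarith [abs_nonneg c, le_abs_self c]
  nlinarith [abs_nonneg c]

theorem integrableOn_pow_mul_exp_neg_cube (n : ℕ) (c : ℝ) :
    IntegrableOn (fun r : ℝ => r ^ n * Real.exp (-r ^ 3 / 3 + c * r)) (Ioi 0) := by
  refine integrable_of_isBigO_exp_neg one_pos (by fun_prop)
    ((Real.isLittleO_pow_exp_atTop.isBigO.mul (exp_neg_cube_add_isBigO c)).congr_right fun r => ?_)
  rw [← Real.exp_add]
  ring_nf

theorem norm_airyMoment_integrand (ω : ℂ) (n : ℕ) (x : ℝ) {r : ℝ} (hr : 0 ≤ r) :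
    ‖(ω * r) ^ n * Complex.exp (-(r : ℂ) ^ 3 / 3 + ω * x * r)‖ =
      ‖ω‖ ^ n * (r ^ n * Real.exp (-r ^ 3 / 3 + ω.re * x * r)) := by
  have hre : (-(r : ℂ) ^ 3 / 3 + ω * x * r).re = -r ^ 3 / 3 + ω.re * x * r := by
    rw [show -(r : ℂ) ^ 3 / 3 + ω * x * r = ((-r ^ 3 / 3 : ℝ) : ℂ) + ω * ((x * r : ℝ) : ℂ) by
      push_cast; ring, Complex.add_re, Complex.ofReal_re, Complex.re_mul_ofReal, mul_assoc]
  rw [norm_mul, norm_pow, norm_mul, Complex.norm_exp, hre, Complex.norm_real,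
    Real.norm_of_nonneg hr, mul_pow, mul_assoc]

theorem integrableOn_airyMoment_integrand (ω : ℂ) (n : ℕ) (x : ℝ) :
    IntegrableOn (fun r : ℝ => (ω * r) ^ n * Complex.exp (-(r : ℂ) ^ 3 / 3 + ω * x * r))
      (Ioi 0) :=
  ((integrableOn_pow_mul_exp_neg_cube n (ω.re * x)).const_mul (‖ω‖ ^ n)).mono' (by fun_prop)
    ((ae_restrict_iff' measurableSet_Ioi).2 (ae_of_all _ fun _ hr =>
      (norm_airyMoment_integrand ω n x (mem_Ioi.1 hr).le).le))

theorem norm_airyMoment_le (ω : ℂ) (n : ℕ) (x : ℝ) :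
    ‖airyMoment ω n x‖ ≤
      ‖ω‖ ^ n * ∫ r in Ioi (0 : ℝ), r ^ n * Real.exp (-r ^ 3 / 3 + ω.re * x * r) := by
  rw [← integral_const_mul]
  exact (norm_integral_le_integral_norm _).trans_eq (setIntegral_congr_fun measurableSet_Ioi
    fun r hr => norm_airyMoment_integrand ω n x (mem_Ioi.1 hr).le)

theorem hasDerivAt_airyMoment (ω : ℂ) (n : ℕ) (x : ℝ) :
    HasDerivAt (airyMoment ω n) (airyMoment ω (n + 1) x) x := by
  refine (hasDerivAt_integral_of_dominated_loc_of_deriv_le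
    (μ := volume.restrict (Ioi (0 : ℝ)))
    (F := fun (y : ℝ) (r : ℝ) => (ω * r) ^ n * Complex.exp (-(r : ℂ) ^ 3 / 3 + ω * y * r))
    (F' := fun (y : ℝ) (r : ℝ) =>
      (ω * r) ^ (n + 1) * Complex.exp (-(r : ℂ) ^ 3 / 3 + ω * y * r))
    (bound := fun r =>
      ‖ω‖ ^ (n + 1) * (r ^ (n + 1) * Real.exp (-r ^ 3 / 3 + ‖ω‖ * (|x| + 1) * r)))
    (Metric.ball_mem_nhds x one_pos) (Eventually.of_forall fun y => by fun_prop)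
    (integrableOn_airyMoment_integrand ω n x) (by fun_prop) ?_
    ((integrableOn_pow_mul_exp_neg_cube _ _).const_mul _) ?_).2
  · refine (ae_restrict_iff' measurableSet_Ioi).2 (ae_of_all _ fun r (hr : 0 < r) y hy => ?_)
    rw [norm_airyMoment_integrand ω _ y hr.le]
    have hy' : |y| ≤ |x| + 1 := by
      have := abs_sub_abs_le_abs_sub y x
      have : |y - x| < 1 := by simpa [Real.dist_eq] using hy
      linarith
    have hωy : ω.re * y ≤ ‖ω‖ * (|x| + 1) :=
      calc ω.re * y ≤ |ω.re| * |y| := (le_abs_self _).trans_eq (abs_mul _ _)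
        _ ≤ _ := mul_le_mul (Complex.abs_re_le_norm ω) hy' (abs_nonneg _) (norm_nonneg _)
    gcongr
  · refine ae_of_all _ fun r y _ => ?_
    have hexponent : HasDerivAt (fun y : ℝ => -(r : ℂ) ^ 3 / 3 + ω * y * r) (ω * r) y := by
      simpa using (((hasDerivAt_id y).ofReal_comp.const_mul ω).mul_const (r : ℂ)).const_add
        (-(r : ℂ) ^ 3 / 3)
    convert! hexponent.cexp.const_mul ((ω * r : ℂ) ^ n) using 1
    ring

theorem tendsto_exp_neg_cube_add (ω : ℂ) (x : ℝ) :
    Tendsto (fun r : ℝ => Complex.exp (-(r : ℂ) ^ 3 / 3 + ω * x * r)) atTop (𝓝 0) := by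
  have hexp : Tendsto (fun r : ℝ => Real.exp (-2 * r)) atTop (𝓝 0) :=
    Real.tendsto_exp_atBot.comp (tendsto_id.const_mul_atTop_of_neg (by norm_num))
  refine squeeze_zero_norm' ?_ ((exp_neg_cube_add_isBigO (ω.re * x)).trans_tendsto hexp)
  filter_upwards [eventually_ge_atTop 0] with r hr
  simpa using (norm_airyMoment_integrand ω 0 x hr).le

theorem airyMoment_two {ω : ℂ} (hω : ω ^ 3 = 1) (x : ℝ) :
    airyMoment ω 2 x = x * airyMoment ω 0 x + ω ^ 2 := by
  set e : ℝ → ℂ := fun r => Complex.exp (-(r : ℂ) ^ 3 / 3 + ω * x * r) with he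
  have hderiv : ∀ r : ℝ, HasDerivAt (fun r => -ω ^ 2 * e r)
      ((ω * r) ^ 2 * e r - x * ((ω * r) ^ 0 * e r)) r := fun r => by
    have hr : HasDerivAt (fun y : ℝ => (y : ℂ)) 1 r := (hasDerivAt_id r).ofReal_comp
    convert! (((hr.pow 3).neg.div_const 3).add (hr.const_mul (ω * x))).cexp.const_mul (-ω ^ 2)
      using 1
    simp only [he]
    push_cast
    linear_combination x * Complex.exp (-(r : ℂ) ^ 3 / 3 + ω * x * r) * hω
  have hint := integrableOn_airyMoment_integrand ω 2 x
  have hint' := (integrableOn_airyMoment_integrand ω 0 x).const_mul (x : ℂ)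
  have hFTC := integral_Ioi_of_hasDerivAt_of_tendsto' (a := 0) (fun r _ => hderiv r)
    (hint.sub hint') ((tendsto_exp_neg_cube_add ω x).const_mul (-ω ^ 2))
  rw [integral_sub hint hint', integral_const_mul] at hFTC
  change airyMoment ω 2 x - x * airyMoment ω 0 x = _ at hFTC
  simp only [he, Complex.ofReal_zero, mul_zero, add_zero, ne_eq, OfNat.ofNat_ne_zero,
    not_false_eq_true, zero_pow, neg_zero, zero_div, Complex.exp_zero, mul_one] at hFTC
  linear_combination hFTC

theorem norm_airyMoment_le_inv_pow {ω : ℂ} (hω : ω.re < 0) (n : ℕ) {x : ℝ} (hx : 0 < x) :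
    ‖airyMoment ω n x‖ ≤ ‖ω‖ ^ n * n.factorial * (-ω.re * x)⁻¹ ^ (n + 1) := by
  have hb : 0 < -ω.re * x := mul_pos (neg_pos.2 hω) hx
  have hrpow : ∀ r : ℝ, r ^ ((n + 1 : ℝ) - 1) * Real.exp (-(-ω.re * x * r)) =
      r ^ n * Real.exp (-(-ω.re * x) * r) := fun r => by
    rw [add_sub_cancel_right, Real.rpow_natCast, neg_mul (-ω.re * x)]
  have hGamma := Real.integral_rpow_mul_exp_neg_mul_Ioi (a := n + 1) (by positivity) hb
  rw [Real.Gamma_nat_eq_factorial, one_div, ← Nat.cast_add_one, Real.rpow_natCast] at hGamma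
  push_cast at hGamma
  simp only [hrpow] at hGamma
  have hint : IntegrableOn (fun r : ℝ => r ^ n * Real.exp (-(-ω.re * x) * r)) (Ioi 0) := by
    simpa using integrableOn_rpow_mul_exp_neg_mul_rpow (s := n) (p := 1)
      (by linarith [n.cast_nonneg (α := ℝ)]) one_pos hb
  rw [mul_assoc, mul_comm (n.factorial : ℝ), ← hGamma]
  refine (norm_airyMoment_le ω n x).trans (mul_le_mul_of_nonneg_left ?_ (by positivity))
  refine setIntegral_mono_on (integrableOn_pow_mul_exp_neg_cube n _) hint measurableSet_Ioi
    fun r (hr : 0 < r) => ?_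
  have : 0 ≤ r ^ 3 := by positivity
  gcongr
  linarith

theorem airyMoment_isBigO {ω : ℂ} (hω : ω.re < 0) (n : ℕ) :
    airyMoment ω n =O[atTop] fun x => x⁻¹ ^ (n + 1) := by
  refine IsBigO.of_bound (‖ω‖ ^ n * n.factorial * (-ω.re)⁻¹ ^ (n + 1)) ?_
  filter_upwards [eventually_gt_atTop 0] with x hx
  rw [Real.norm_of_nonneg (by positivity), mul_assoc, ← mul_pow, ← mul_inv]
  exact norm_airyMoment_le_inv_pow hω n hx

theorem airyMoment_apply_zero (ω : ℂ) (n : ℕ) :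
    airyMoment ω n 0 = ω ^ n * ((∫ r in Ioi (0 : ℝ), r ^ n * Real.exp (-r ^ 3 / 3) : ℝ) : ℂ) := by
  rw [airyMoment, ← integral_complex_ofReal, ← integral_const_mul]
  congr 1 with r
  push_cast
  rw [mul_zero, zero_mul, add_zero]
  ring

/-- Euler's reflection formula: the factors are `3^{-2/3} Γ(1/3)` and `3^{-1/3} Γ(2/3)`. -/
theorem integral_exp_neg_cube_mul_integral_mul_exp_neg_cube :
    (∫ r in Ioi (0 : ℝ), r ^ 0 * Real.exp (-r ^ 3 / 3)) *
      (∫ r in Ioi (0 : ℝ), r ^ 1 * Real.exp (-r ^ 3 / 3)) = 2 * Real.pi / (3 * √3) := by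
  have hGamma : ∀ n : ℕ, ∫ r in Ioi (0 : ℝ), r ^ n * Real.exp (-r ^ 3 / 3) =
      (1 / 3 : ℝ) ^ (-((n : ℝ) + 1) / 3) * (1 / 3) * Real.Gamma (((n : ℝ) + 1) / 3) := fun n => by
    rw [← integral_rpow_mul_exp_neg_mul_rpow (by norm_num)
      (by linarith [n.cast_nonneg (α := ℝ)]) (by norm_num)]
    congr 1 with r
    rw [Real.rpow_natCast, show r ^ (3 : ℝ) = r ^ 3 by exact_mod_cast Real.rpow_natCast r 3]
    ring_nf
  have hreflection := Real.Gamma_mul_Gamma_one_sub (1 / 3)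
  rw [mul_one_div, Real.sin_pi_div_three, show (1 : ℝ) - 1 / 3 = 2 / 3 by norm_num]
    at hreflection
  have hpow : (1 / 3 : ℝ) ^ (-1 / 3 : ℝ) * (1 / 3 : ℝ) ^ (-2 / 3 : ℝ) = 3 := by
    rw [← Real.rpow_add (by norm_num)]
    norm_num
  rw [hGamma 0, hGamma 1]
  norm_num only [Nat.cast_zero, Nat.cast_one]
  norm_num only at hreflection hpow
  linear_combination (1 / 9) * Real.Gamma (1 / 3) * Real.Gamma (2 / 3) * hpow
    + (1 / 3) * hreflection

end Moments

section AiryEquation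

/-- The primitive cube root of unity `exp (2πi/3)`. The integrands of `Ai` and `Bi` live on the
rays spanned by it, its conjugate and `1`, after the substitution `z ↦ -z` in the contour. -/
def cubeRoot : ℂ := ⟨-1 / 2, √3 / 2⟩

/-- The twelfth root of unity `exp (πi/6)`, by which the zeroth moment along `cubeRoot` is rotated
so that its real and imaginary parts give `Ai` and the oscillating part of `Bi`. -/
def twelfthRoot : ℂ := ⟨√3 / 2, 1 / 2⟩

theorem cubeRoot_pow_three : cubeRoot ^ 3 = 1 := by
  have h := Real.mul_self_sqrt (zero_le_three (α := ℝ))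
  apply Complex.ext <;> simp only [cubeRoot, pow_succ, pow_zero, one_mul, Complex.mul_re,
    Complex.mul_im, Complex.one_re, Complex.one_im]
  · linear_combination 3 / 8 * h
  · linear_combination -(√3 / 8) * h

theorem twelfthRoot_mul_cubeRoot_sq : twelfthRoot * cubeRoot ^ 2 = -Complex.I := by
  have h := Real.mul_self_sqrt (zero_le_three (α := ℝ))
  apply Complex.ext <;> simp only [cubeRoot, twelfthRoot, pow_succ, pow_zero, one_mul,
    Complex.mul_re, Complex.mul_im, Complex.neg_re, Complex.neg_im, Complex.I_re, Complex.I_im]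
  · linear_combination -(√3 / 8) * h
  · linear_combination -(3 / 8) * h

theorem cubeRoot_re_neg : cubeRoot.re < 0 := by norm_num [cubeRoot]

theorem twelfthRoot_eq_exp : twelfthRoot = Complex.exp ((Real.pi / 6 : ℝ) * Complex.I) := by
  rw [Complex.exp_mul_I, ← Complex.ofReal_cos, ← Complex.ofReal_sin, Real.cos_pi_div_six,
    Real.sin_pi_div_six]
  apply Complex.ext <;> simp [twelfthRoot]

theorem twelfthRoot_mul_exp (x r : ℝ) :
    twelfthRoot * Complex.exp (-(r : ℂ) ^ 3 / 3 + cubeRoot * x * r) =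
      ⟨Real.exp (-r ^ 3 / 3 - x * r / 2) * Real.cos (√3 / 2 * (x * r) + Real.pi / 6),
        Real.exp (-r ^ 3 / 3 - x * r / 2) * Real.sin (√3 / 2 * (x * r) + Real.pi / 6)⟩ := by
  have hroot : cubeRoot = ((-1 / 2 : ℝ) : ℂ) + ((√3 / 2 : ℝ) : ℂ) * Complex.I := by
    apply Complex.ext <;> simp [cubeRoot]
  have hexponent : ((Real.pi / 6 : ℝ) : ℂ) * Complex.I + (-(r : ℂ) ^ 3 / 3 + cubeRoot * x * r) =
      ((-r ^ 3 / 3 - x * r / 2 : ℝ) : ℂ) +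
        ((√3 / 2 * (x * r) + Real.pi / 6 : ℝ) : ℂ) * Complex.I := by
    rw [hroot]
    push_cast
    ring
  rw [twelfthRoot_eq_exp, ← Complex.exp_add, hexponent]
  apply Complex.ext
  · simp only [Complex.exp_re, Complex.add_re, Complex.add_im, Complex.ofReal_re,
      Complex.ofReal_im, Complex.re_ofReal_mul, Complex.im_ofReal_mul, Complex.I_re, Complex.I_im,
      mul_zero, mul_one, add_zero, zero_add]
  · simp only [Complex.exp_im, Complex.add_re, Complex.add_im, Complex.ofReal_re,
      Complex.ofReal_im, Complex.re_ofReal_mul, Complex.im_ofReal_mul, Complex.I_re, Complex.I_im,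
      mul_zero, mul_one, add_zero, zero_add]

theorem Ai_eq (x : ℝ) : Ai x = Real.pi⁻¹ * (twelfthRoot * airyMoment cubeRoot 0 x).re := by
  have hint := (integrableOn_airyMoment_integrand cubeRoot 0 x).const_mul twelfthRoot
  have hre := integral_re (𝕜 := ℂ) hint
  simp only [pow_zero, one_mul, twelfthRoot_mul_exp] at hre
  rw [airyMoment, ← integral_const_mul, Ai]
  simp only [pow_zero, one_mul, twelfthRoot_mul_exp]
  exact congrArg _ hre

theorem Bi_eq (x : ℝ) : Bi x = Real.pi⁻¹ *
    ((airyMoment 1 0 x).re + (twelfthRoot * airyMoment cubeRoot 0 x).im) := by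
  have hint₁ := integrableOn_airyMoment_integrand 1 0 x
  have hint₂ := (integrableOn_airyMoment_integrand cubeRoot 0 x).const_mul twelfthRoot
  have hexp : ∀ r : ℝ, Complex.exp (-(r : ℂ) ^ 3 / 3 + x * r) =
      (Real.exp (-r ^ 3 / 3 + x * r) : ℝ) := fun r => by push_cast; ring_nf
  have hsum := integral_add hint₁.re hint₂.im
  have hre := integral_re (𝕜 := ℂ) hint₁
  have him := integral_im (𝕜 := ℂ) hint₂
  rw [hre, him] at hsum
  simp only [pow_zero, one_mul, twelfthRoot_mul_exp, hexp] at hsum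
  rw [airyMoment, airyMoment, ← integral_const_mul, Bi]
  simp only [pow_zero, one_mul, twelfthRoot_mul_exp, hexp]
  exact congrArg _ hsum

theorem hasDerivAt_twelfthRoot_mul_airyMoment_re (n : ℕ) (x : ℝ) :
    HasDerivAt (fun x => (twelfthRoot * airyMoment cubeRoot n x).re)
      (twelfthRoot * airyMoment cubeRoot (n + 1) x).re x :=
  Complex.reCLM.hasFDerivAt.comp_hasDerivAt x ((hasDerivAt_airyMoment cubeRoot n x).const_mul _)

theorem hasDerivAt_twelfthRoot_mul_airyMoment_im (n : ℕ) (x : ℝ) :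
    HasDerivAt (fun x => (twelfthRoot * airyMoment cubeRoot n x).im)
      (twelfthRoot * airyMoment cubeRoot (n + 1) x).im x :=
  Complex.imCLM.hasFDerivAt.comp_hasDerivAt x ((hasDerivAt_airyMoment cubeRoot n x).const_mul _)

theorem hasDerivAt_airyMoment_one_re (n : ℕ) (x : ℝ) :
    HasDerivAt (fun x => (airyMoment 1 n x).re) (airyMoment 1 (n + 1) x).re x :=
  Complex.reCLM.hasFDerivAt.comp_hasDerivAt x (hasDerivAt_airyMoment 1 n x)

theorem deriv_Ai (x : ℝ) :
    deriv Ai x = Real.pi⁻¹ * (twelfthRoot * airyMoment cubeRoot 1 x).re := by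
  rw [funext Ai_eq]
  exact ((hasDerivAt_twelfthRoot_mul_airyMoment_re 0 x).const_mul _).deriv

theorem deriv_Bi (x : ℝ) : deriv Bi x = Real.pi⁻¹ *
    ((airyMoment 1 1 x).re + (twelfthRoot * airyMoment cubeRoot 1 x).im) := by
  rw [funext Bi_eq]
  exact (((hasDerivAt_airyMoment_one_re 0 x).add
    (hasDerivAt_twelfthRoot_mul_airyMoment_im 0 x)).const_mul _).deriv

theorem hasDerivAt_Ai (x : ℝ) : HasDerivAt Ai (deriv Ai x) x := by
  rw [deriv_Ai, funext Ai_eq]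
  exact (hasDerivAt_twelfthRoot_mul_airyMoment_re 0 x).const_mul _

theorem hasDerivAt_Bi (x : ℝ) : HasDerivAt Bi (deriv Bi x) x := by
  rw [deriv_Bi, funext Bi_eq]
  exact ((hasDerivAt_airyMoment_one_re 0 x).add
    (hasDerivAt_twelfthRoot_mul_airyMoment_im 0 x)).const_mul _

theorem twelfthRoot_mul_airyMoment_two (x : ℝ) : twelfthRoot * airyMoment cubeRoot 2 x =
    x * (twelfthRoot * airyMoment cubeRoot 0 x) - Complex.I := by
  rw [airyMoment_two cubeRoot_pow_three]
  linear_combination twelfthRoot_mul_cubeRoot_sq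

theorem hasDerivAt_deriv_Ai (x : ℝ) : HasDerivAt (deriv Ai) (x * Ai x) x := by
  rw [funext deriv_Ai]
  convert! (hasDerivAt_twelfthRoot_mul_airyMoment_re 1 x).const_mul Real.pi⁻¹ using 1
  rw [Ai_eq, twelfthRoot_mul_airyMoment_two, Complex.sub_re, Complex.re_ofReal_mul, Complex.I_re]
  ring

theorem hasDerivAt_deriv_Bi (x : ℝ) : HasDerivAt (deriv Bi) (x * Bi x) x := by
  rw [funext deriv_Bi]
  convert! ((hasDerivAt_airyMoment_one_re 1 x).add
    (hasDerivAt_twelfthRoot_mul_airyMoment_im 1 x)).const_mul Real.pi⁻¹ using 1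
  rw [Bi_eq, twelfthRoot_mul_airyMoment_two, airyMoment_two (one_pow 3), Complex.sub_im,
    Complex.im_ofReal_mul, Complex.I_im, one_pow, Complex.add_re, Complex.one_re,
    Complex.re_ofReal_mul]
  ring

theorem continuous_Ai : Continuous Ai :=
  continuous_iff_continuousAt.2 fun x => (hasDerivAt_Ai x).continuousAt

theorem continuous_Bi : Continuous Bi :=
  continuous_iff_continuousAt.2 fun x => (hasDerivAt_Bi x).continuousAt

theorem continuous_deriv_Ai : Continuous (deriv Ai) :=
  continuous_iff_continuousAt.2 fun x => (hasDerivAt_deriv_Ai x).continuousAt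

theorem continuous_deriv_Bi : Continuous (deriv Bi) :=
  continuous_iff_continuousAt.2 fun x => (hasDerivAt_deriv_Bi x).continuousAt

theorem wronskian_at_zero : Ai 0 * deriv Bi 0 - deriv Ai 0 * Bi 0 = Real.pi⁻¹ := by
  have hprod := integral_exp_neg_cube_mul_integral_mul_exp_neg_cube
  rw [Ai_eq, Bi_eq, deriv_Ai, deriv_Bi]
  simp only [airyMoment_apply_zero]
  set G₀ := ∫ r in Ioi (0 : ℝ), r ^ 0 * Real.exp (-r ^ 3 / 3)
  set G₁ := ∫ r in Ioi (0 : ℝ), r ^ 1 * Real.exp (-r ^ 3 / 3)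
  rw [eq_div_iff (by positivity)] at hprod
  simp only [twelfthRoot, cubeRoot, pow_zero, pow_one, one_mul, Complex.mul_re,
    Complex.mul_im, Complex.ofReal_re, Complex.ofReal_im, mul_zero, sub_zero, zero_add]
  field_simp
  linear_combination (4 : ℝ) * hprod +
    G₀ * G₁ * √3 * Real.mul_self_sqrt (zero_le_three (α := ℝ))

theorem wronskian (x : ℝ) : Ai x * deriv Bi x - deriv Ai x * Bi x = Real.pi⁻¹ := by
  have hderiv : ∀ y, HasDerivAt (fun y => Ai y * deriv Bi y - deriv Ai y * Bi y) 0 y := fun y => by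
    convert! ((hasDerivAt_Ai y).mul (hasDerivAt_deriv_Bi y)).sub
      ((hasDerivAt_deriv_Ai y).mul (hasDerivAt_Bi y)) using 1
    ring
  exact (is_const_of_deriv_eq_zero (fun y => (hderiv y).differentiableAt)
    (fun y => (hderiv y).deriv) x 0).trans wronskian_at_zero

end AiryEquation

section ExpDecay

/-- The rate `exp (-a t^{3/2})` in which all estimates are expressed: decay for `a > 0`, growth
for `a < 0`. -/
def expDecay (a t : ℝ) : ℝ := Real.exp (-a * t ^ (3 / 2 : ℝ))

theorem expDecay_pos (a t : ℝ) : 0 < expDecay a t := Real.exp_pos _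

theorem expDecay_add (a b t : ℝ) : expDecay (a + b) t = expDecay a t * expDecay b t := by
  rw [expDecay, expDecay, expDecay, ← Real.exp_add]
  ring_nf

theorem hasDerivAt_expDecay (a t : ℝ) :
    HasDerivAt (expDecay a) (-(3 / 2) * a * √t * expDecay a t) t := by
  have hpow := Real.hasDerivAt_rpow_const (x := t) (p := 3 / 2) (Or.inr (by norm_num))
  convert! (hpow.const_mul (-a)).exp using 1
  rw [expDecay, Real.sqrt_eq_rpow]
  norm_num
  ring

theorem tendsto_expDecay_atTop {a : ℝ} (ha : a < 0) : Tendsto (expDecay a) atTop atTop :=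
  Real.tendsto_exp_atTop.comp
    ((tendsto_rpow_atTop (by norm_num)).const_mul_atTop (neg_pos.2 ha))

theorem tendsto_expDecay_zero {a : ℝ} (ha : 0 < a) : Tendsto (expDecay a) atTop (𝓝 0) :=
  Real.tendsto_exp_atBot.comp
    ((tendsto_rpow_atTop (by norm_num)).const_mul_atTop_of_neg (neg_lt_zero.2 ha))

theorem hasDerivAt_sqrt_mul_expDecay (a : ℝ) {t : ℝ} (ht : 0 < t) :
    HasDerivAt (fun t => √t * expDecay a t) ((1 / (2 * √t) - 3 / 2 * a * t) * expDecay a t) t := by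
  convert! (Real.hasDerivAt_sqrt ht.ne').mul (hasDerivAt_expDecay a t) using 1
  linear_combination (-(3 / 2) * a * expDecay a t) * -Real.mul_self_sqrt ht.le

end ExpDecay

section Comparison

variable {f f' : ℝ → ℝ} {a : ℝ}

theorem neg_le_deriv_of_antitoneOn_add {U h : ℝ → ℝ} {X : ℝ}
    (hU : ∀ x, X ≤ x → HasDerivAt U (f x) x) (hbdd : BddBelow (U '' Ici X))
    (hanti : AntitoneOn (fun x => f x + h x) (Ici X)) (hh : ∀ x, X ≤ x → 0 ≤ h x)
    {x : ℝ} (hx : X ≤ x) : -h x ≤ f x := by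
  by_contra! hlt
  obtain ⟨m, hm⟩ := hbdd
  set c := -(f x + h x)
  have hc0 : 0 < c := by linarith
  have hslope : ∀ z ∈ Ici x, f z ≤ -c := fun z hz => by
    have : f z + h z ≤ f x + h x := hanti hx (hx.trans hz) hz
    linarith [hh z (hx.trans hz)]
  set z := x + (U x - m + 1) / c with hz
  have hxz : x ≤ z := by
    have := hm (mem_image_of_mem U (mem_Ici.2 hx))
    have : 0 ≤ (U x - m + 1) / c := div_nonneg (by linarith) hc0.le
    linarith
  have hdecrease : U z - U x ≤ -c * (z - x) :=
    (convex_Ici x).image_sub_le_mul_sub_of_deriv_le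
      (fun w hw => (hU w (hx.trans hw)).continuousAt.continuousWithinAt)
      (fun w hw => (hU w (hx.trans (interior_subset hw))).differentiableAt.differentiableWithinAt)
      (fun w hw => (hU w (hx.trans (interior_subset hw))).deriv.trans_le
        (hslope w (interior_subset hw))) x self_mem_Ici z hxz hxz
  have hcz : c * (z - x) = U x - m + 1 := by rw [hz]; field_simp; ring
  have := hm (mem_image_of_mem U (mem_Ici.2 (hx.trans hxz)))
  linarith

theorem eventually_neg_le_of_deriv_le_expDecay {U : ℝ → ℝ} {c : ℝ} (ha : 0 < a) (hc : 0 ≤ c)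
    (hU : ∀ x, HasDerivAt U (f x) x) (hf : ∀ x, HasDerivAt f (f' x) x)
    (hbdd : IsBoundedUnder (· ≥ ·) atTop U)
    (hf' : ∀ᶠ x in atTop, f' x ≤ a * c * (x * expDecay a x)) :
    ∀ᶠ x in atTop, -(c * (√x * expDecay a x)) ≤ f x := by
  obtain ⟨m, hm⟩ := hbdd.eventually_ge
  obtain ⟨X, hX⟩ := eventually_atTop.1 ((hm.and hf').and
    (eventually_ge_atTop (max 1 a⁻¹)))
  refine eventually_atTop.2 ⟨X, fun x hx => neg_le_deriv_of_antitoneOn_add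
    (fun x _ => hU x) ⟨m, forall_mem_image.2 fun x hx => (hX x hx).1.1⟩ ?_
    (fun x _ => mul_nonneg hc (mul_nonneg (Real.sqrt_nonneg x) (expDecay_pos a x).le)) hx⟩
  have hpos : ∀ x, X ≤ x → 0 < x := fun x hx =>
    one_pos.trans_le ((le_max_left _ _).trans (hX x hx).2)
  have hderiv : ∀ x, X ≤ x → HasDerivAt (fun x => f x + c * (√x * expDecay a x))
      (f' x + c * ((1 / (2 * √x) - 3 / 2 * a * x) * expDecay a x)) x := fun x hx =>
    (hf x).add ((hasDerivAt_sqrt_mul_expDecay a (hpos x hx)).const_mul c)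
  refine antitoneOn_of_hasDerivWithinAt_nonpos (convex_Ici X)
    (fun x hx => (hderiv x hx).continuousAt.continuousWithinAt)
    (fun x hx => (hderiv x (interior_subset hx)).hasDerivWithinAt)
    fun x hx => ?_
  obtain ⟨⟨-, hle⟩, hx1⟩ := hX x (interior_subset hx)
  have hsqrt : 1 / (2 * √x) ≤ 1 / 2 :=
    one_div_le_one_div_of_le two_pos (by linarith [Real.one_le_sqrt.2 (le_of_max_le_left hx1)])
  have hax : 1 ≤ a * x := (inv_le_iff_one_le_mul₀' ha).1 (le_of_max_le_right hx1)
  have := mul_nonneg (mul_nonneg hc (expDecay_pos a x).le)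
    (by linarith : 0 ≤ a * x / 2 - 1 / (2 * √x))
  linarith

theorem isLittleO_sqrt_mul_expDecay_of_deriv_of_pos {U : ℝ → ℝ} (ha : 0 < a)
    (hU : ∀ x, HasDerivAt U (f x) x) (hf : ∀ x, HasDerivAt f (f' x) x)
    (hbdd : U =O[atTop] (1 : ℝ → ℝ)) (hf' : f' =o[atTop] fun x => x * expDecay a x) :
    f =o[atTop] fun x => √x * expDecay a x := by
  refine isLittleO_iff.2 fun c hc => ?_
  have hbdd' := isBoundedUnder_le_abs.1 ((isBigO_one_iff ℝ).1 hbdd)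
  have hf'c := (hf'.bound (mul_pos ha hc)).and (eventually_ge_atTop 0)
  have habs : ∀ x, 0 ≤ x → ‖x * expDecay a x‖ = x * expDecay a x := fun x hx =>
    Real.norm_of_nonneg (mul_nonneg hx (expDecay_pos a x).le)
  have hlower := eventually_neg_le_of_deriv_le_expDecay ha hc.le hU hf hbdd'.2 <| hf'c.mono
    fun x hx => (le_abs_self _).trans (hx.1.trans_eq (by rw [habs x hx.2]))
  have hupper := eventually_neg_le_of_deriv_le_expDecay ha hc.le (fun x => (hU x).neg)
    (fun x => (hf x).neg) (isBoundedUnder_ge_neg.2 hbdd'.1) <| hf'c.mono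
    fun x hx => (neg_le_abs _).trans (hx.1.trans_eq (by rw [habs x hx.2]))
  filter_upwards [hlower, hupper] with x hl hu
  rw [Real.norm_of_nonneg (mul_nonneg (Real.sqrt_nonneg x) (expDecay_pos a x).le)]
  exact abs_le.2 ⟨hl, by linarith⟩

theorem isLittleO_sqrt_mul_expDecay_of_deriv_of_neg (ha : a < 0)
    (hf : ∀ x, HasDerivAt f (f' x) x) (hf' : f' =o[atTop] fun x => x * expDecay a x) :
    f =o[atTop] fun x => √x * expDecay a x := by
  have htop : Tendsto (fun x => √x * expDecay a x) atTop atTop :=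
    Real.tendsto_sqrt_atTop.atTop_mul_atTop₀ (tendsto_expDecay_atTop ha)
  refine isLittleO_iff.2 fun c hc => ?_
  obtain ⟨X, hX⟩ := eventually_atTop.1
    ((hf'.bound (c := -a * (c / 2)) (mul_pos (neg_pos.2 ha) (by positivity))).and
      (eventually_gt_atTop 0))
  have hgrowth : ∀ x, X ≤ x → ‖f x‖ ≤ ‖f X‖ + c / 2 * (√x * expDecay a x) := fun x hx => by
    have hX0 := mul_nonneg (Real.sqrt_nonneg X) (expDecay_pos a X).le
    have hbound : ∀ y, X ≤ y → HasDerivAt (fun y => ‖f X‖ + c / 2 * (√y * expDecay a y))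
        (c / 2 * ((1 / (2 * √y) - 3 / 2 * a * y) * expDecay a y)) y := fun y hy =>
      ((hasDerivAt_sqrt_mul_expDecay a (hX y hy).2).const_mul (c / 2)).const_add _
    refine image_norm_le_of_norm_deriv_right_le_deriv_boundary'
      (fun y _ => (hf y).continuousAt.continuousWithinAt)
      (fun y _ => (hf y).hasDerivWithinAt) (by nlinarith)
      (fun y hy => (hbound y hy.1).continuousAt.continuousWithinAt)
      (fun y hy => (hbound y hy.1).hasDerivWithinAt) (fun y hy => ?_) (right_mem_Icc.2 hx)
    obtain ⟨hle, hy0⟩ := hX y hy.1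
    have hE := expDecay_pos a y
    rw [Real.norm_of_nonneg (mul_nonneg hy0.le hE.le)] at hle
    have hgain : 0 ≤ 1 / (2 * √y) - a * y / 2 := by
      have := mul_nonneg (neg_pos.2 ha).le hy0.le
      have : 0 ≤ 1 / (2 * √y) := by positivity
      linarith
    have := mul_nonneg (mul_nonneg hc.le hE.le) hgain
    linarith
  filter_upwards [eventually_ge_atTop X, htop.eventually_ge_atTop (2 * ‖f X‖ / c)] with x hx hlarge
  have h0 := mul_nonneg (Real.sqrt_nonneg x) (expDecay_pos a x).le
  rw [div_le_iff₀ hc] at hlarge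
  rw [Real.norm_of_nonneg h0]
  linarith [hgrowth x hx]

end Comparison

section Riccati

variable {y y' p p' q : ℝ → ℝ} {X : ℝ}

theorem mul_deriv_add_mul_nonpos (hy : ∀ x, X ≤ x → HasDerivAt y (y' x) x)
    (hy' : ∀ x, X ≤ x → HasDerivAt y' (q x * y x) x) (hp : ∀ x, X ≤ x → HasDerivAt p (p' x) x)
    (hpq : ∀ x, X ≤ x → p x ^ 2 ≤ q x + p' x)
    (hlim : Tendsto (fun x => y x * (y' x + p x * y x)) atTop (𝓝 0)) {x : ℝ} (hx : X ≤ x) :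
    y x * (y' x + p x * y x) ≤ 0 := by
  have hderiv : ∀ x, X ≤ x → HasDerivAt (fun x => y x * (y' x + p x * y x))
      (y' x * (y' x + p x * y x) + y x * (q x * y x + (p' x * y x + p x * y' x))) x := fun x hx =>
    (hy x hx).mul ((hy' x hx).add ((hp x hx).mul (hy x hx)))
  have hmono : MonotoneOn (fun x => y x * (y' x + p x * y x)) (Ici X) := by
    refine monotoneOn_of_hasDerivWithinAt_nonneg (convex_Ici X)
      (fun x hx => (hderiv x hx).continuousAt.continuousWithinAt)
      (fun x hx => (hderiv x (interior_subset hx)).hasDerivWithinAt) fun x hx => ?_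
    have := mul_nonneg (sub_nonneg.2 (hpq x (interior_subset hx))) (sq_nonneg (y x))
    nlinarith [sq_nonneg (y' x + p x * y x)]
  refine ge_of_tendsto hlim ?_
  filter_upwards [eventually_ge_atTop x] with z hz
  exact hmono hx (hx.trans hz) hz

theorem antitoneOn_sq_mul_weight {w : ℝ → ℝ} (hy : ∀ x, X ≤ x → HasDerivAt y (y' x) x)
    (hw : ∀ x, X ≤ x → HasDerivAt w (2 * p x * w x) x) (hw0 : ∀ x, X ≤ x → 0 ≤ w x)
    (hyp : ∀ x, X ≤ x → y x * (y' x + p x * y x) ≤ 0) :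
    AntitoneOn (fun x => y x ^ 2 * w x) (Ici X) := by
  have hderiv : ∀ x, X ≤ x → HasDerivAt (fun x => y x ^ 2 * w x)
      (2 * w x * (y x * (y' x + p x * y x))) x := fun x hx => by
    convert! ((hy x hx).pow 2).mul (hw x hx) using 1
    simp only [Pi.pow_apply]
    ring
  exact antitoneOn_of_hasDerivWithinAt_nonpos (convex_Ici X)
    (fun x hx => (hderiv x hx).continuousAt.continuousWithinAt)
    (fun x hx => (hderiv x (interior_subset hx)).hasDerivWithinAt)
    fun x hx => mul_nonpos_of_nonneg_of_nonpos
      (mul_nonneg two_pos.le (hw0 x (interior_subset hx))) (hyp x (interior_subset hx))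

end Riccati

section AiryAsymptotics

theorem twelfthRoot_mul_airyMoment_isBigO (n : ℕ) :
    (fun x => twelfthRoot * airyMoment cubeRoot n x) =O[atTop] fun x => x⁻¹ ^ (n + 1) :=
  (airyMoment_isBigO cubeRoot_re_neg n).const_mul_left twelfthRoot

theorem Ai_isBigO_inv : Ai =O[atTop] fun x => x⁻¹ := by
  rw [funext Ai_eq]
  refine IsBigO.const_mul_left ((isBigO_of_le _ fun x => Complex.abs_re_le_norm _).trans ?_) _
  simpa using twelfthRoot_mul_airyMoment_isBigO 0

theorem deriv_Ai_isBigO_one : deriv Ai =O[atTop] (1 : ℝ → ℝ) := by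
  rw [funext deriv_Ai]
  refine IsBigO.const_mul_left ((isBigO_of_le _ fun x => Complex.abs_re_le_norm _).trans ?_) _
  exact (twelfthRoot_mul_airyMoment_isBigO 1).trans
    ((tendsto_inv_atTop_zero.pow 2).isBigO_one ℝ)

/-- Minus the logarithmic derivative of `x^{-1/8} exp (-2/3 x^{3/2})`. The exponent `1/8`, short of
the true asymptotic exponent `1/4` of `Ai`, leaves the slack needed for the barrier inequality on
all of `[1, ∞)`. -/
def riccatiBarrier (x : ℝ) : ℝ := √x + 1 / 8 * x⁻¹

theorem hasDerivAt_riccatiBarrier {x : ℝ} (hx : 0 < x) :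
    HasDerivAt riccatiBarrier (1 / (2 * √x) + 1 / 8 * -(x ^ 2)⁻¹) x :=
  (Real.hasDerivAt_sqrt hx.ne').add ((hasDerivAt_inv hx.ne').const_mul _)

theorem riccatiBarrier_sq_le {x : ℝ} (hx : 1 ≤ x) :
    riccatiBarrier x ^ 2 ≤ x + (1 / (2 * √x) + 1 / 8 * -(x ^ 2)⁻¹) := by
  have hs := Real.one_le_sqrt.2 hx
  have hss : √x ^ 2 = x := Real.sq_sqrt (by positivity)
  rw [riccatiBarrier, ← sub_nonneg]
  generalize √x = s at hs hss
  subst hss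
  have hdiff : s ^ 2 + (1 / (2 * s) + 1 / 8 * -((s ^ 2) ^ 2)⁻¹) - (s + 1 / 8 * (s ^ 2)⁻¹) ^ 2 =
      (16 * s ^ 3 - 9) / (64 * s ^ 4) := by
    field_simp
    ring
  rw [hdiff]
  exact div_nonneg (by linarith [one_le_pow₀ hs (n := 3)]) (by positivity)

theorem riccatiBarrier_isBigO : riccatiBarrier =O[atTop] fun x => x := by
  refine IsBigO.of_bound 2 ?_
  filter_upwards [eventually_ge_atTop 1] with x hx
  have hsqrt : √x ≤ x := (Real.sqrt_le_left (by positivity)).2 (le_self_pow₀ hx two_ne_zero)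
  have hinv : x⁻¹ ≤ 1 := inv_le_one_of_one_le₀ hx
  have : 0 ≤ riccatiBarrier x := by unfold riccatiBarrier; positivity
  rw [Real.norm_of_nonneg this, Real.norm_of_nonneg (by positivity), riccatiBarrier]
  linarith

theorem tendsto_Ai_mul_deriv_add :
    Tendsto (fun x => Ai x * (deriv Ai x + riccatiBarrier x * Ai x)) atTop (𝓝 0) := by
  have hcancel : (fun x : ℝ => x * x⁻¹) =ᶠ[atTop] 1 := by
    filter_upwards [eventually_ne_atTop 0] with x hx using mul_inv_cancel₀ hx
  have hfactor : (fun x => deriv Ai x + riccatiBarrier x * Ai x) =O[atTop] (1 : ℝ → ℝ) :=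
    deriv_Ai_isBigO_one.add ((riccatiBarrier_isBigO.mul Ai_isBigO_inv).trans_eventuallyEq hcancel)
  refine (Ai_isBigO_inv.mul hfactor).trans_tendsto ?_
  simpa using tendsto_inv_atTop_zero (𝕜 := ℝ)

theorem antitoneOn_Ai_sq_mul :
    AntitoneOn (fun x => Ai x ^ 2 * (x ^ (1 / 4 : ℝ) * expDecay (-(4 / 3)) x)) (Ici 1) := by
  have hpos : ∀ {x : ℝ}, 1 ≤ x → 0 < x := one_pos.trans_le
  refine antitoneOn_sq_mul_weight (p := riccatiBarrier) (fun x _ => hasDerivAt_Ai x)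
    (fun x hx => ?_) (fun x hx => mul_nonneg (Real.rpow_nonneg (hpos hx).le _)
      (expDecay_pos _ _).le) fun x hx => mul_deriv_add_mul_nonpos (fun x _ => hasDerivAt_Ai x)
      (fun x _ => hasDerivAt_deriv_Ai x) (fun x hx => hasDerivAt_riccatiBarrier (hpos hx))
      (fun x hx => riccatiBarrier_sq_le hx) tendsto_Ai_mul_deriv_add hx
  convert! (Real.hasDerivAt_rpow_const (p := 1 / 4) (Or.inl (hpos hx).ne')).mul
    (hasDerivAt_expDecay (-(4 / 3)) x) using 1
  rw [Real.rpow_sub_one (hpos hx).ne', riccatiBarrier]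
  ring

theorem Ai_isLittleO : Ai =o[atTop] expDecay (2 / 3) := by
  refine IsLittleO.of_pow (n := 2) ?_ two_ne_zero
  have hdecay : (fun x : ℝ => x ^ (-(1 / 4) : ℝ)) =o[atTop] (1 : ℝ → ℝ) :=
    (isLittleO_one_iff ℝ).2 (tendsto_rpow_neg_atTop (by norm_num))
  refine (IsBigO.trans_isLittleO (IsBigO.of_bound (Ai 1 ^ 2 * (1 ^ (1 / 4 : ℝ) *
    expDecay (-(4 / 3)) 1)) ?_) (hdecay.mul_isBigO
      (isBigO_refl (fun x => expDecay (2 / 3) x ^ 2) atTop))).congr_right (fun x => by simp)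
  filter_upwards [eventually_ge_atTop 1] with x hx
  have hx0 : 0 < x := one_pos.trans_le hx
  have hweight : x ^ (1 / 4 : ℝ) * expDecay (-(4 / 3)) x *
      (x ^ (-(1 / 4) : ℝ) * expDecay (2 / 3) x ^ 2) = 1 := by
    have hE : expDecay (-(4 / 3)) x * expDecay (2 / 3) x ^ 2 = 1 := by
      rw [sq, ← expDecay_add, ← expDecay_add]
      norm_num [expDecay]
    have hrpow : x ^ (1 / 4 : ℝ) * x ^ (-(1 / 4) : ℝ) = 1 := by
      rw [← Real.rpow_add hx0]
      norm_num
    rw [mul_mul_mul_comm, hrpow, hE, one_mul]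
  have hanti := antitoneOn_Ai_sq_mul self_mem_Ici hx hx
  have hE := expDecay_pos (2 / 3) x
  rw [Pi.pow_apply, Real.norm_of_nonneg (sq_nonneg _), Real.norm_of_nonneg (by positivity)]
  calc Ai x ^ 2 = Ai x ^ 2 * (x ^ (1 / 4 : ℝ) * expDecay (-(4 / 3)) x) *
        (x ^ (-(1 / 4) : ℝ) * expDecay (2 / 3) x ^ 2) := by rw [mul_assoc, hweight, mul_one]
    _ ≤ _ := by gcongr

theorem norm_airyMoment_one_zero_le {x : ℝ} (hx : 0 < x) :
    ‖airyMoment 1 0 x‖ ≤ expDecay (-(2 / 3)) x * √(Real.pi / (2 / 3 * √x)) := by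
  refine (norm_airyMoment_le 1 0 x).trans ?_
  have : 0 < √x := Real.sqrt_pos.2 hx
  have hss : √x ^ 2 = x := Real.sq_sqrt hx.le
  have hgaussian := ((integrable_exp_neg_mul_sq (b := 2 / 3 * √x) (by positivity)).comp_sub_right
    (√x)).const_mul (expDecay (-(2 / 3)) x)
  rw [norm_one, one_pow, one_mul, ← integral_gaussian,
    ← integral_sub_right_eq_self (fun r => Real.exp (-(2 / 3 * √x) * r ^ 2)) (√x),
    ← integral_const_mul]
  refine (setIntegral_mono_on (integrableOn_pow_mul_exp_neg_cube 0 _) hgaussian.integrableOn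
    measurableSet_Ioi fun r (hr : 0 < r) => ?_).trans (setIntegral_le_integral hgaussian
      (ae_of_all _ fun r => mul_nonneg (expDecay_pos _ _).le (Real.exp_nonneg _)))
  have hx3 : x ^ (3 / 2 : ℝ) = √x ^ 3 := by
    rw [Real.sqrt_eq_rpow, ← Real.rpow_natCast, ← Real.rpow_mul hx.le]
    norm_num
  rw [pow_zero, one_mul, expDecay, ← Real.exp_add, Real.exp_le_exp, hx3, Complex.one_re, one_mul]
  have htaylor : -r ^ 3 / 3 + √x ^ 2 * r =
      2 / 3 * √x ^ 3 - 2 / 3 * √x * (r - √x) ^ 2 - r / 3 * (r - √x) ^ 2 := by ring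
  rw [hss] at htaylor
  linarith [mul_nonneg hr.le (sq_nonneg (r - √x))]

theorem airyMoment_one_zero_isLittleO : airyMoment 1 0 =o[atTop] expDecay (-(2 / 3)) := by
  have hfactor : Tendsto (fun x => √(Real.pi / (2 / 3 * √x))) atTop (𝓝 0) := by
    rw [← Real.sqrt_zero]
    exact (tendsto_const_nhds.div_atTop
      (Real.tendsto_sqrt_atTop.const_mul_atTop (by norm_num))).sqrt
  refine IsBigO.trans_isLittleO (IsBigO.of_bound 1 ?_) (((isBigO_refl (expDecay (-(2 / 3)))
    atTop).mul_isLittleO ((isLittleO_one_iff ℝ).2 hfactor)).congr_right fun x => mul_one _)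
  filter_upwards [eventually_gt_atTop 0] with x hx
  rw [one_mul]
  exact (norm_airyMoment_one_zero_le hx).trans (le_abs_self _)

theorem Bi_isLittleO : Bi =o[atTop] expDecay (-(2 / 3)) := by
  rw [funext Bi_eq]
  have hosc : (fun x => twelfthRoot * airyMoment cubeRoot 0 x) =o[atTop] expDecay (-(2 / 3)) :=
    ((twelfthRoot_mul_airyMoment_isBigO 0).trans_tendsto
      (by simpa using tendsto_inv_atTop_zero (𝕜 := ℝ))).isBigO_one ℝ |>.trans_isLittleO
        ((isLittleO_one_left_iff ℝ).2 (tendsto_norm_atTop_atTop.comp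
          (tendsto_expDecay_atTop (by norm_num))))
  exact IsLittleO.const_mul_left
    (((isBigO_of_le _ fun x => Complex.abs_re_le_norm _).trans_isLittleO
      airyMoment_one_zero_isLittleO).add
      ((isBigO_of_le _ fun x => Complex.abs_im_le_norm _).trans_isLittleO hosc)) _

theorem deriv_Ai_isLittleO : deriv Ai =o[atTop] fun x => √x * expDecay (2 / 3) x :=
  isLittleO_sqrt_mul_expDecay_of_deriv_of_pos (by norm_num) hasDerivAt_Ai hasDerivAt_deriv_Ai
    ((Ai_isBigO_inv.trans_tendsto tendsto_inv_atTop_zero).isBigO_one ℝ)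
    ((isBigO_refl _ _).mul_isLittleO Ai_isLittleO)

theorem deriv_Bi_isLittleO : deriv Bi =o[atTop] fun x => √x * expDecay (-(2 / 3)) x :=
  isLittleO_sqrt_mul_expDecay_of_deriv_of_neg (by norm_num) hasDerivAt_deriv_Bi
    ((isBigO_refl _ _).mul_isLittleO Bi_isLittleO)

end AiryAsymptotics

section Threshold

variable {u : ℝ → ℝ}

theorem IsHastingsMcLeod.contDiff (hu : IsHastingsMcLeod u) : ContDiff ℝ 1 u :=
  contDiff_one_iff_deriv.2 ⟨hu.differentiable,
    continuous_iff_continuousAt.2 fun t => (hu.painleve t).continuousAt⟩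

theorem IsHastingsMcLeod.isLittleO (hu : IsHastingsMcLeod u) : u =o[atTop] expDecay (2 / 3) :=
  hu.asymp.isBigO.trans_isLittleO Ai_isLittleO

theorem IsHastingsMcLeod.isBigO_one (hu : IsHastingsMcLeod u) : u =O[atTop] (1 : ℝ → ℝ) :=
  hu.isLittleO.isBigO.trans ((tendsto_expDecay_zero (by norm_num)).isBigO_one ℝ)

theorem IsHastingsMcLeod.deriv_isLittleO (hu : IsHastingsMcLeod u) :
    deriv u =o[atTop] fun x => √x * expDecay (2 / 3) x := by
  have hcube : (fun x => 2 * u x ^ 3) =o[atTop] fun x => x * expDecay (2 / 3) x := by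
    have hsq : (fun x => 2 * u x ^ 2) =O[atTop] fun x => x :=
      ((hu.isBigO_one.pow 2).const_mul_left 2).trans
        ((isLittleO_const_id_atTop (1 : ℝ)).isBigO.congr_left fun _ => (one_pow 2).symm)
    refine (hsq.mul_isLittleO hu.isLittleO).congr_left fun x => by ring
  exact isLittleO_sqrt_mul_expDecay_of_deriv_of_pos (by norm_num)
    (fun x => (hu.differentiable x).hasDerivAt) hu.painleve hu.isBigO_one
    (((isBigO_refl _ _).mul_isLittleO hu.isLittleO).add hcube)

theorem eventually_abs_lt_of_isLittleO {α : Type*} {l : Filter α} {f w : α → ℝ}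
    (h : f =o[l] w) (hw : ∀ᶠ x in l, 0 < w x) : ∀ᶠ x in l, |f x| < w x := by
  filter_upwards [h.bound one_half_pos, hw] with x hx hwx
  rw [Real.norm_eq_abs, Real.norm_of_nonneg hwx.le] at hx
  linarith

theorem exists_isThreshold (hu : IsHastingsMcLeod u) : ∃ T, IsThreshold u T := by
  have hE : ∀ a : ℝ, ∀ᶠ x in atTop, 0 < expDecay a x := fun a =>
    Eventually.of_forall (expDecay_pos a)
  have hsqrtE : ∀ a : ℝ, ∀ᶠ x in atTop, 0 < √x * expDecay a x := fun a => by
    filter_upwards [eventually_gt_atTop 0] with x hx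
    exact mul_pos (Real.sqrt_pos.2 hx) (expDecay_pos a x)
  obtain ⟨X, hX⟩ := eventually_atTop.1 <|
    ((eventually_abs_lt_of_isLittleO Bi_isLittleO (hE _)).and
      (eventually_abs_lt_of_isLittleO deriv_Bi_isLittleO (hsqrtE _))).and <|
    ((eventually_abs_lt_of_isLittleO Ai_isLittleO (hE _)).and
      (eventually_abs_lt_of_isLittleO deriv_Ai_isLittleO (hsqrtE _))).and <|
    ((eventually_abs_lt_of_isLittleO hu.isLittleO (hE _)).and
      (eventually_abs_lt_of_isLittleO hu.deriv_isLittleO (hsqrtE _))).and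
    (eventually_ge_atTop 1)
  simp only [expDecay, neg_mul, neg_neg, mul_comm (√_)] at hX
  have hscale : (1 : ℝ) ≤ 3 ^ (2 / 3 : ℝ) := Real.one_le_rpow (by norm_num) (by norm_num)
  have hX1 : 1 ≤ X := (hX X le_rfl).2.2.2
  have hXT : X ≤ X * 3 ^ (2 / 3 : ℝ) := le_mul_of_one_le_right (by linarith) hscale
  have hdiv : X * 3 ^ (2 / 3 : ℝ) / 3 ^ (2 / 3 : ℝ) = X := mul_div_cancel_right₀ _ (by positivity)
  refine ⟨X * 3 ^ (2 / 3 : ℝ), hX1.trans hXT, ?_, ?_, fun x hx => (hX x (hXT.trans hx)).2.2.1⟩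
  · rw [hdiv]; exact fun x hx => (hX x hx).1
  · rw [hdiv]; exact fun x hx => (hX x hx).2.1

end Threshold

section IntegralsFromInfinity

theorem expDecay_anti {a b t : ℝ} (hab : a ≤ b) (ht : 0 ≤ t) : expDecay b t ≤ expDecay a t :=
  Real.exp_le_exp.2 (by gcongr)

theorem hasDerivAt_neg_expDecay_div {a : ℝ} (ha : a ≠ 0) (t : ℝ) :
    HasDerivAt (fun s => -(2 / 3 / a) * expDecay a s) (√t * expDecay a t) t := by
  convert! (hasDerivAt_expDecay a t).const_mul (-(2 / 3 / a)) using 1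
  field_simp

theorem integrableOn_sqrt_mul_expDecay {a : ℝ} (ha : 0 < a) (t : ℝ) :
    IntegrableOn (fun s => √s * expDecay a s) (Ioi t) :=
  integrableOn_Ioi_deriv_of_nonneg' (fun x _ => hasDerivAt_neg_expDecay_div ha.ne' x)
    (fun x _ => mul_nonneg (Real.sqrt_nonneg x) (expDecay_pos a x).le)
    ((tendsto_expDecay_zero ha).const_mul _)

theorem integral_sqrt_mul_expDecay {a : ℝ} (ha : 0 < a) (t : ℝ) :
    ∫ s in Ioi t, √s * expDecay a s = 2 / 3 / a * expDecay a t := by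
  rw [integral_Ioi_of_hasDerivAt_of_tendsto' (fun x _ => hasDerivAt_neg_expDecay_div ha.ne' x)
    (integrableOn_sqrt_mul_expDecay ha t) ((tendsto_expDecay_zero ha).const_mul _)]
  ring

theorem setIntegral_lt_setIntegral_of_forall_lt {α : Type*} [MeasurableSpace α] {μ : Measure α}
    {f₁ f₂ : α → ℝ} {s : Set α} (hs : MeasurableSet s) (hμ : μ s ≠ 0) (hf₁ : IntegrableOn f₁ s μ)
    (hf₂ : IntegrableOn f₂ s μ) (h : ∀ x ∈ s, f₁ x < f₂ x) :
    ∫ x in s, f₁ x ∂μ < ∫ x in s, f₂ x ∂μ := by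
  have hsupport : Function.support (fun x => f₂ x - f₁ x) ∩ s = s :=
    inter_eq_right.2 fun x hx => (sub_pos.2 (h x hx)).ne'
  rw [← sub_pos, ← integral_sub hf₂ hf₁, setIntegral_pos_iff_support_of_nonneg_ae
    ((ae_restrict_iff' hs).2 (ae_of_all _ fun x hx => (sub_pos.2 (h x hx)).le)) (hf₂.sub hf₁),
    hsupport]
  exact hμ.bot_lt

variable {f₁ f₂ : ℝ → ℝ} {T t b c : ℝ}

theorem integrableOn_of_le_sqrt_mul_expDecay (hb : 0 < b)
    (hf : AEStronglyMeasurable f₁ (volume.restrict (Ioi T)))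
    (h : ∀ s, T ≤ s → |f₁ s| ≤ c * (√s * expDecay b s)) : IntegrableOn f₁ (Ioi T) :=
  Integrable.mono' ((integrableOn_sqrt_mul_expDecay hb T).const_mul c) hf
    ((ae_restrict_iff' measurableSet_Ioi).2 (ae_of_all _ fun s (hs : T < s) => h s hs.le))

theorem abs_intFromInfty_le (hb : 0 < b) (h : ∀ s, t ≤ s → |f₁ s| ≤ c * (√s * expDecay b s)) :
    |intFromInfty f₁ t| ≤ c * (2 / 3 / b) * expDecay b t := by
  rw [intFromInfty, abs_neg, mul_assoc, ← integral_sqrt_mul_expDecay hb, ← integral_const_mul]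
  exact norm_integral_le_of_norm_le (f := f₁) ((integrableOn_sqrt_mul_expDecay hb t).const_mul c)
    ((ae_restrict_iff' measurableSet_Ioi).2 (ae_of_all _ fun s (hs : t < s) => h s hs.le))

theorem abs_intFromInfty_lt (hb : 0 < b) (hf : IntegrableOn f₁ (Ioi t))
    (h : ∀ s, t ≤ s → |f₁ s| < c * (√s * expDecay b s)) :
    |intFromInfty f₁ t| < c * (2 / 3 / b) * expDecay b t := by
  rw [intFromInfty, abs_neg, mul_assoc, ← integral_sqrt_mul_expDecay hb, ← integral_const_mul]
  exact abs_integral_le_integral_abs.trans_lt <|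
    setIntegral_lt_setIntegral_of_forall_lt measurableSet_Ioi (by simp) hf.abs
      ((integrableOn_sqrt_mul_expDecay hb t).const_mul c) fun s (hs : t < s) => h s hs.le

theorem continuousOn_intFromInfty (hf : IntegrableOn f₁ (Ioi T)) :
    ContinuousOn (intFromInfty f₁) (Ici T) :=
  hf.continuousOn_Ici_primitive_Ioi.neg

theorem hasDerivWithinAt_intFromInfty (hf : IntegrableOn f₁ (Ioi T)) (hc : ContinuousOn f₁ (Ici T))
    (ht : T ≤ t) : HasDerivWithinAt (intFromInfty f₁) (f₁ t) (Ici T) t := by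
  have hcont : Continuous fun s => f₁ (max s T) :=
    hc.comp_continuous (by fun_prop) fun s => le_max_right s T
  have hderiv := ((hcont.integral_hasStrictDerivAt T t).hasDerivAt).const_add (intFromInfty f₁ T)
  rw [max_eq_left ht] at hderiv
  have heq : ∀ t ∈ Ici T, intFromInfty f₁ t = intFromInfty f₁ T + ∫ s in T..t, f₁ (max s T) := by
    intro t (ht : T ≤ t)
    have hmax : ∫ s in T..t, f₁ (max s T) = ∫ s in T..t, f₁ s :=
      intervalIntegral.integral_congr fun s hs => by
        rw [uIcc_of_le ht] at hs
        exact congrArg f₁ (max_eq_left hs.1)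
    rw [hmax, ← intervalIntegral.integral_Ioi_sub_Ioi hf ht, intFromInfty, intFromInfty]
    ring
  exact hderiv.hasDerivWithinAt.congr heq (heq t ht)

theorem intFromInfty_congr (h : ∀ s, t ≤ s → f₁ s = f₂ s) :
    intFromInfty f₁ t = intFromInfty f₂ t :=
  congrArg Neg.neg (setIntegral_congr_fun measurableSet_Ioi fun s (hs : t < s) => h s hs.le)

theorem intFromInfty_sum_const_mul {ι : Type*} {F : Finset ι} {f : ι → ℝ → ℝ} (c : ι → ℝ)
    (hf : ∀ m ∈ F, IntegrableOn (f m) (Ioi t)) :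
    intFromInfty (fun s => ∑ m ∈ F, c m * f m s) t = ∑ m ∈ F, c m * intFromInfty (f m) t := by
  simp only [intFromInfty, integral_finsetSum F fun m hm => (hf m hm).const_mul (c m),
    integral_const_mul, Finset.sum_neg_distrib, mul_neg]

theorem tendsto_intFromInfty {F : ℕ → ℝ → ℝ} (hb : 0 < b)
    (hF : ∀ n, AEStronglyMeasurable (F n) (volume.restrict (Ioi t)))
    (h : ∀ n s, t ≤ s → |F n s| ≤ c * (√s * expDecay b s))
    (hlim : ∀ s, t ≤ s → Tendsto (fun n => F n s) atTop (𝓝 (f₁ s))) :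
    Tendsto (fun n => intFromInfty (F n) t) atTop (𝓝 (intFromInfty f₁ t)) :=
  (tendsto_integral_of_dominated_convergence _ hF
    ((integrableOn_sqrt_mul_expDecay hb t).const_mul c)
    (fun n => (ae_restrict_iff' measurableSet_Ioi).2 (ae_of_all _ fun s (hs : t < s) =>
      h n s hs.le))
    ((ae_restrict_iff' measurableSet_Ioi).2 (ae_of_all _ fun s (hs : t < s) =>
      hlim s hs.le))).neg

end IntegralsFromInfinity

section Scaling

/-- The real cube root of `3`, in terms of which `sc t = t / cbrtThree ^ 2`. -/
def cbrtThree : ℝ := (3 : ℝ) ^ (1 / 3 : ℝ)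

theorem cbrtThree_pos : 0 < cbrtThree := Real.rpow_pos_of_pos (by norm_num) _

theorem cbrtThree_pow_three : cbrtThree ^ 3 = 3 := by
  rw [cbrtThree, ← Real.rpow_natCast, ← Real.rpow_mul (by norm_num)]
  norm_num

theorem sc_eq_div (t : ℝ) : sc t = t / cbrtThree ^ 2 := by
  rw [sc, cbrtThree, ← Real.rpow_natCast, ← Real.rpow_mul (by norm_num)]
  norm_num

theorem sqrt_sc (t : ℝ) : √(sc t) = √t / cbrtThree := by
  rw [sc_eq_div, Real.sqrt_div' _ (by positivity), Real.sqrt_sq cbrtThree_pos.le]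

theorem sc_rpow_three_halves {t : ℝ} (ht : 0 ≤ t) :
    sc t ^ (3 / 2 : ℝ) = t ^ (3 / 2 : ℝ) / 3 := by
  rw [sc, Real.div_rpow ht (by positivity), ← Real.rpow_mul (by norm_num)]
  norm_num

theorem hasDerivAt_sc (t : ℝ) : HasDerivAt sc (1 / cbrtThree ^ 2) t := by
  rw [funext sc_eq_div]
  exact (hasDerivAt_id' t).div_const _

theorem continuous_sc : Continuous sc := continuous_id.div_const _

theorem hasDerivAt_g_zero (t : ℝ) : HasDerivAt (g 0) 0 t := hasDerivAt_const t 0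

theorem hasDerivAt_g_one (t : ℝ) : HasDerivAt (g 1) (deriv Bi (sc t) * (1 / cbrtThree ^ 2)) t :=
  (hasDerivAt_Bi (sc t)).comp t (hasDerivAt_sc t)

theorem hasDerivAt_g_two (t : ℝ) : HasDerivAt (g 2) (deriv Ai (sc t) * (1 / cbrtThree ^ 2)) t :=
  (hasDerivAt_Ai (sc t)).comp t (hasDerivAt_sc t)

theorem hasDerivAt_g : ∀ (k : Fin 3) (t : ℝ), HasDerivAt (g k) (deriv (g k) t) t
  | 0, t => (hasDerivAt_g_zero t).differentiableAt.hasDerivAt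
  | 1, t => (hasDerivAt_g_one t).differentiableAt.hasDerivAt
  | 2, t => (hasDerivAt_g_two t).differentiableAt.hasDerivAt

theorem hasDerivAt_airy_comp_sc {y : ℝ → ℝ} {y' t : ℝ} (hy : HasDerivAt y (sc t * y') (sc t)) :
    HasDerivAt (fun s => y (sc s) * (1 / cbrtThree ^ 2)) (t * y' / 9) t := by
  convert! (hy.comp t (hasDerivAt_sc t)).mul_const (1 / cbrtThree ^ 2) using 1
  have h9 : cbrtThree ^ 6 = 9 := by
    rw [show cbrtThree ^ 6 = (cbrtThree ^ 3) ^ 2 by ring, cbrtThree_pow_three]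
    norm_num
  have := cbrtThree_pos
  rw [sc_eq_div, ← h9]
  field_simp

theorem hasDerivAt_deriv_g : ∀ (k : Fin 3) (t : ℝ), HasDerivAt (deriv (g k)) (t * g k t / 9) t
  | 0, t => by
    rw [funext fun s => (hasDerivAt_g_zero s).deriv]
    simpa [g] using hasDerivAt_const t (0 : ℝ)
  | 1, t => by
    rw [funext fun s => (hasDerivAt_g_one s).deriv]
    exact hasDerivAt_airy_comp_sc (hasDerivAt_deriv_Bi (sc t))
  | 2, t => by
    rw [funext fun s => (hasDerivAt_g_two s).deriv]
    exact hasDerivAt_airy_comp_sc (hasDerivAt_deriv_Ai (sc t))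

theorem continuous_g (k : Fin 3) : Continuous (g k) :=
  continuous_iff_continuousAt.2 fun t => (hasDerivAt_g k t).continuousAt

theorem continuous_deriv_g (k : Fin 3) : Continuous (deriv (g k)) :=
  continuous_iff_continuousAt.2 fun t => (hasDerivAt_deriv_g k t).continuousAt

end Scaling

section ThresholdEstimates

variable {u : ℝ → ℝ} {T t : ℝ}

theorem IsThreshold.pos (h : IsThreshold u T) : 0 < T := one_pos.trans_le h.one_le

theorem IsThreshold.nonneg_of_le (h : IsThreshold u T) (ht : T ≤ t) : 0 ≤ t := h.pos.le.trans ht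

theorem div_le_sc (ht : T ≤ t) : T / (3 : ℝ) ^ (2 / 3 : ℝ) ≤ sc t :=
  div_le_div_of_nonneg_right ht (by positivity)

theorem exp_neg_two_thirds_mul_sc_rpow (ht : 0 ≤ t) :
    Real.exp (-(2 / 3 * sc t ^ (3 / 2 : ℝ))) = expDecay (2 / 9) t := by
  rw [sc_rpow_three_halves ht, expDecay]
  ring_nf

theorem exp_two_thirds_mul_sc_rpow (ht : 0 ≤ t) :
    Real.exp (2 / 3 * sc t ^ (3 / 2 : ℝ)) = expDecay (-(2 / 9)) t := by
  rw [sc_rpow_three_halves ht, expDecay]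
  ring_nf

theorem IsThreshold.abs_Ai_lt (h : IsThreshold u T) (ht : T ≤ t) :
    |Ai (sc t)| < expDecay (2 / 9) t := by
  rw [← exp_neg_two_thirds_mul_sc_rpow (h.nonneg_of_le ht)]
  exact (h.ai _ (div_le_sc ht)).1

theorem IsThreshold.abs_deriv_Ai_lt (h : IsThreshold u T) (ht : T ≤ t) :
    |deriv Ai (sc t)| < √t / cbrtThree * expDecay (2 / 9) t := by
  rw [← exp_neg_two_thirds_mul_sc_rpow (h.nonneg_of_le ht), ← sqrt_sc, mul_comm]
  exact (h.ai _ (div_le_sc ht)).2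

theorem IsThreshold.abs_Bi_lt (h : IsThreshold u T) (ht : T ≤ t) :
    |Bi (sc t)| < expDecay (-(2 / 9)) t := by
  rw [← exp_two_thirds_mul_sc_rpow (h.nonneg_of_le ht)]
  exact (h.bi _ (div_le_sc ht)).1

theorem IsThreshold.abs_deriv_Bi_lt (h : IsThreshold u T) (ht : T ≤ t) :
    |deriv Bi (sc t)| < √t / cbrtThree * expDecay (-(2 / 9)) t := by
  rw [← exp_two_thirds_mul_sc_rpow (h.nonneg_of_le ht), ← sqrt_sc, mul_comm]
  exact (h.bi _ (div_le_sc ht)).2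

theorem IsThreshold.abs_u_lt (h : IsThreshold u T) (ht : T ≤ t) : |u t| < expDecay (2 / 3) t := by
  simpa only [expDecay, neg_mul] using (h.hm t ht).1

theorem IsThreshold.abs_deriv_u_lt (h : IsThreshold u T) (ht : T ≤ t) :
    |deriv u t| < √t * expDecay (2 / 3) t := by
  simpa only [expDecay, neg_mul, mul_comm (√t)] using (h.hm t ht).2

end ThresholdEstimates

section Constants

theorem pi_pow_succ_mul_three_rpow (j : ℕ) :
    Real.pi ^ (j + 1) * (3 : ℝ) ^ (-((j + 1 : ℕ) : ℝ) / 3) =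
      Real.pi / cbrtThree * (Real.pi ^ j * (3 : ℝ) ^ (-(j : ℝ) / 3)) := by
  have hpow : (3 : ℝ) ^ (-((j + 1 : ℕ) : ℝ) / 3) = (3 : ℝ) ^ (-(j : ℝ) / 3) / cbrtThree := by
    rw [cbrtThree, ← Real.rpow_sub (by norm_num)]
    push_cast
    ring_nf
  rw [hpow, pow_succ]
  ring

/-- The constants `C_{1k}^{(j)}`, extended to `j = 0` so as to bound the initial iterate: the value
is `1` for `k = 1, 2`, and `0` (not the `3` given by the formula for `C₁ 0 0`) for `k = 0`. -/
def boundOne (k : Fin 3) (j : ℕ) : ℝ := (3 * j + (k : ℕ)) * C₀ k j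

theorem prod_Icc_three_mul_add_div {a : ℝ} (ha : 0 < a) (j : ℕ) :
    ∏ i ∈ Finset.Icc 1 j, (3 * (i : ℝ) + a) / (3 * i + a - 3) = (3 * j + a) / a := by
  induction j with
  | zero => simp [ha.ne']
  | succ j ih =>
    rw [Finset.prod_Icc_succ_top (by omega), ih]
    push_cast
    rw [show 3 * ((j : ℝ) + 1) + a - 3 = 3 * j + a by ring]
    field_simp

theorem C₁_succ_eq_boundOne : ∀ (k : Fin 3) (j : ℕ), C₁ k (j + 1) = boundOne k (j + 1)
  | 0, j => by
    simp only [boundOne, C₁, C₀, Nat.factorial_succ, Nat.add_sub_cancel, Matrix.cons_val,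
      Fin.val_zero]
    push_cast
    field_simp
    ring_nf
  | 1, j => by
    have hprod : ∏ i ∈ Finset.Icc 1 (j + 1), (6 * (i : ℝ) - 1) / ((3 * i - 1) * (3 * i - 2)) =
        (∏ i ∈ Finset.Icc 1 (j + 1), (3 * (i : ℝ) + 1) / (3 * i + 1 - 3)) *
          ∏ i ∈ Finset.Icc 1 (j + 1), (6 * (i : ℝ) - 1) / ((3 * i - 1) * (3 * i + 1)) := by
      rw [← Finset.prod_mul_distrib]
      refine Finset.prod_congr rfl fun i _ => ?_
      rw [show 3 * (i : ℝ) + 1 - 3 = 3 * i - 2 by ring]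
      field_simp
    simp only [boundOne, C₁, C₀, Matrix.cons_val, Fin.val_one, Nat.cast_one, hprod,
      prod_Icc_three_mul_add_div one_pos]
    ring
  | 2, j => by
    have hprod : ∏ i ∈ Finset.Icc 1 (j + 1), (6 * (i : ℝ) + 1) / (3 * i * (3 * i - 1)) =
        (∏ i ∈ Finset.Icc 1 (j + 1), (3 * (i : ℝ) + 2) / (3 * i + 2 - 3)) *
          ∏ i ∈ Finset.Icc 1 (j + 1), (6 * (i : ℝ) + 1) / (3 * i * (3 * i + 2)) := by
      rw [← Finset.prod_mul_distrib]
      refine Finset.prod_congr rfl fun i _ => ?_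
      rw [show 3 * (i : ℝ) + 2 - 3 = 3 * i - 1 by ring]
      field_simp
    simp only [boundOne, C₁, C₀, Matrix.cons_val, Fin.val_two, Nat.cast_ofNat, hprod,
      prod_Icc_three_mul_add_div two_pos]
    ring

theorem C₀_succ : ∀ (k : Fin 3) (j : ℕ), C₀ k (j + 1) = Real.pi / cbrtThree *
    ((2 * (3 * j + (k : ℕ)) + 3) / ((3 * j + (k : ℕ) + 1) * (3 * j + (k : ℕ) + 3))) * C₀ k j
  | 0, j => by
    simp only [C₀, pi_pow_succ_mul_three_rpow, Matrix.cons_val, Fin.val_zero,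
      Finset.prod_Icc_succ_top (Nat.le_add_left 1 j), Nat.factorial_succ]
    push_cast
    generalize ∏ i ∈ Finset.Icc 1 j, (2 * (i : ℝ) - 1) / (3 * (i : ℝ) - 2) = P
    rw [show 3 * ((j : ℝ) + 1) - 2 = 3 * j + 1 by ring]
    field_simp
    ring
  | 1, j => by
    simp only [C₀, pi_pow_succ_mul_three_rpow, Matrix.cons_val, Fin.val_one,
      Finset.prod_Icc_succ_top (Nat.le_add_left 1 j)]
    push_cast
    ring_nf
  | 2, j => by
    simp only [C₀, pi_pow_succ_mul_three_rpow, Matrix.cons_val, Fin.val_two,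
      Finset.prod_Icc_succ_top (Nat.le_add_left 1 j)]
    push_cast
    ring_nf

theorem C₀_pos (k : Fin 3) : ∀ j, 0 < C₀ k j
  | 0 => by fin_cases k <;> simp [C₀]
  | j + 1 => by
    have := C₀_pos k j
    have := cbrtThree_pos
    rw [C₀_succ]
    positivity

theorem boundOne_nonneg (k : Fin 3) (j : ℕ) : 0 ≤ boundOne k j :=
  mul_nonneg (by positivity) (C₀_pos k j).le

theorem boundOne_succ (k : Fin 3) (j : ℕ) : boundOne k (j + 1) = Real.pi / cbrtThree *
    ((2 * (3 * j + (k : ℕ)) + 3) / (3 * j + (k : ℕ) + 1)) * C₀ k j := by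
  rw [boundOne, C₀_succ]
  push_cast
  field_simp
  ring

theorem pi_div_cbrtThree_le : Real.pi / cbrtThree ≤ Real.pi :=
  div_le_self Real.pi_pos.le (Real.one_le_rpow (by norm_num) (by norm_num))

theorem boundOne_succ_le (k : Fin 3) (j : ℕ) : boundOne k (j + 1) ≤ 3 * Real.pi * C₀ k j := by
  have hfrac : (2 * (3 * j + (k : ℕ)) + 3) / (3 * j + (k : ℕ) + 1) ≤ (3 : ℝ) :=
    (div_le_iff₀ (by positivity)).2 (by linarith [(j.cast_nonneg : (0 : ℝ) ≤ j),
      ((k : ℕ).cast_nonneg : (0 : ℝ) ≤ ((k : ℕ) : ℝ))])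
  rw [boundOne_succ, mul_comm 3 Real.pi]
  have := C₀_pos k j
  gcongr
  exact pi_div_cbrtThree_le

theorem summable_C₀ (k : Fin 3) : Summable (C₀ k) := by
  refine summable_of_ratio_norm_eventually_le (r := 1 / 2) (by norm_num) ?_
  filter_upwards [eventually_ge_atTop 7] with j hj
  have hj : (7 : ℝ) ≤ j := Nat.ofNat_le_cast.2 hj
  rw [Real.norm_of_nonneg (C₀_pos k _).le, Real.norm_of_nonneg (C₀_pos k _).le]
  have hle : boundOne k (j + 1) ≤ 3 * 4 * C₀ k j := (boundOne_succ_le k j).trans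
    (by gcongr; exacts [(C₀_pos k j).le, Real.pi_le_four])
  rw [boundOne, Nat.cast_add_one] at hle
  have hcoef : (24 : ℝ) ≤ 3 * (j + 1) + (k : ℕ) := by
    linarith [((k : ℕ).cast_nonneg : (0 : ℝ) ≤ ((k : ℕ) : ℝ))]
  linarith [mul_le_mul_of_nonneg_right hcoef (C₀_pos k (j + 1)).le]

theorem summable_boundOne (k : Fin 3) : Summable (boundOne k) :=
  (summable_nat_add_iff 1).1 <| ((summable_C₀ k).mul_left (3 * Real.pi)).of_nonneg_of_le
    (fun j => boundOne_nonneg k (j + 1)) (boundOne_succ_le k)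

end Constants

section PicardOperator

/-- The integral `A[φ]`. -/
def integralA (u : ℝ → ℝ) (φ : Fin 3 → ℝ → ℝ) : ℝ → ℝ :=
  intFromInfty fun s => Ai (sc s) * source u φ s

/-- The integral `B[φ]`. -/
def integralB (u : ℝ → ℝ) (φ : Fin 3 → ℝ → ℝ) : ℝ → ℝ :=
  intFromInfty fun s => Bi (sc s) * source u φ s

/-- The combination `a B[φ] - b A[φ]` of variation of parameters, with `a` and `b` evaluated at
`t / 3^{2/3}`. The integral equations use it for `(a, b) = (Ai, Bi)` and `(Ai', Bi')`. -/
def airyVariation (a b : ℝ → ℝ) (u : ℝ → ℝ) (φ : Fin 3 → ℝ → ℝ) (t : ℝ) : ℝ :=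
  a (sc t) * integralB u φ t - b (sc t) * integralA u φ t

/-- The right-hand side `(1/3) u' φ₁ - (2/3) u φ₂` of the equation for `φ₀'`. -/
def sourceZero (u φ₁ φ₂ : ℝ → ℝ) (s : ℝ) : ℝ :=
  1 / 3 * deriv u s * φ₁ s - 2 / 3 * u s * φ₂ s

/-- The homogeneous linear part of `rhsOne`. -/
def picardOne (u : ℝ → ℝ) (φ : Fin 3 → ℝ → ℝ) (t : ℝ) : ℝ :=
  2 * Real.pi / cbrtThree * airyVariation Ai Bi u φ t

/-- The homogeneous linear part of `rhsTwo`. -/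
def picardTwo (u : ℝ → ℝ) (φ : Fin 3 → ℝ → ℝ) (t : ℝ) : ℝ :=
  -Real.pi * airyVariation (deriv Ai) (deriv Bi) u φ t

/-- The linear operator taking the difference of two consecutive Picard iterates to the next
difference. -/
def picard (u : ℝ → ℝ) (φ : Fin 3 → ℝ → ℝ) : Fin 3 → ℝ → ℝ :=
  ![intFromInfty (sourceZero u (picardOne u φ) (picardTwo u φ)), picardOne u φ, picardTwo u φ]

theorem rhsOne_eq (u : ℝ → ℝ) (k : Fin 3) (φ : Fin 3 → ℝ → ℝ) (t : ℝ) :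
    rhsOne u k φ t = g k t + picardOne u φ t := rfl

theorem rhsTwo_eq (u : ℝ → ℝ) (k : Fin 3) (φ : Fin 3 → ℝ → ℝ) (t : ℝ) :
    rhsTwo u k φ t = -(3 / 2) * deriv (g k) t + picardTwo u φ t := by
  rw [picardTwo, neg_mul Real.pi, ← sub_eq_add_neg]
  rfl

variable {u : ℝ → ℝ} {φ ψ : Fin 3 → ℝ → ℝ} {T t : ℝ}

theorem IntegralsConverge.mono (hφ : IntegralsConverge u T φ) (ht : T ≤ t) :
    IntegralsConverge u t φ :=
  ⟨hφ.1.mono_set (Ioi_subset_Ioi ht), hφ.2.1.mono_set (Ioi_subset_Ioi ht),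
    hφ.2.2.mono_set (Ioi_subset_Ioi ht)⟩

section Congruence

theorem source_congr {s : ℝ} (h : ∀ i, φ i s = ψ i s) : source u φ s = source u ψ s := by
  rw [source, source, h, h]

theorem airyVariation_congr (a b : ℝ → ℝ) (h : ∀ i s, t ≤ s → φ i s = ψ i s) :
    airyVariation a b u φ t = airyVariation a b u ψ t := by
  have hA : integralA u φ t = integralA u ψ t := intFromInfty_congr fun s hs =>
    congrArg (Ai (sc s) * ·) (source_congr fun i => h i s hs)
  have hB : integralB u φ t = integralB u ψ t := intFromInfty_congr fun s hs =>
    congrArg (Bi (sc s) * ·) (source_congr fun i => h i s hs)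
  rw [airyVariation, airyVariation, hA, hB]

theorem picardOne_congr (h : ∀ i s, t ≤ s → φ i s = ψ i s) : picardOne u φ t = picardOne u ψ t :=
  congrArg (_ * ·) (airyVariation_congr Ai Bi h)

theorem picardTwo_congr (h : ∀ i s, t ≤ s → φ i s = ψ i s) : picardTwo u φ t = picardTwo u ψ t :=
  congrArg (_ * ·) (airyVariation_congr (deriv Ai) (deriv Bi) h)

theorem intFromInfty_sourceZero_congr {φ₁ φ₂ ψ₁ ψ₂ : ℝ → ℝ} (h₁ : ∀ s, t ≤ s → φ₁ s = ψ₁ s)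
    (h₂ : ∀ s, t ≤ s → φ₂ s = ψ₂ s) :
    intFromInfty (sourceZero u φ₁ φ₂) t = intFromInfty (sourceZero u ψ₁ ψ₂) t :=
  intFromInfty_congr fun s hs => by rw [sourceZero, sourceZero, h₁ s hs, h₂ s hs]

end Congruence

section Linearity

variable {ι : Type*} {F : Finset ι} {φ : ι → Fin 3 → ℝ → ℝ}

theorem source_sum (c : ι → ℝ) (s : ℝ) :
    source u (∑ m ∈ F, c m • φ m) s = ∑ m ∈ F, c m * source u (φ m) s := by
  simp only [source, Finset.sum_apply, Pi.smul_apply, smul_eq_mul, Finset.mul_sum,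
    ← Finset.sum_sub_distrib]
  exact Finset.sum_congr rfl fun _ _ => by ring

theorem sourceZero_sum (c : ι → ℝ) (s : ℝ) :
    sourceZero u ((∑ m ∈ F, c m • φ m) 1) ((∑ m ∈ F, c m • φ m) 2) s =
      ∑ m ∈ F, c m * sourceZero u (φ m 1) (φ m 2) s := by
  simp only [sourceZero, Finset.sum_apply, Pi.smul_apply, smul_eq_mul, Finset.mul_sum,
    ← Finset.sum_sub_distrib]
  exact Finset.sum_congr rfl fun _ _ => by ring

theorem airyVariation_sum (a b : ℝ → ℝ) (c : ι → ℝ)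
    (hφ : ∀ m ∈ F, IntegralsConverge u t (φ m)) :
    airyVariation a b u (∑ m ∈ F, c m • φ m) t = ∑ m ∈ F, c m * airyVariation a b u (φ m) t := by
  have hA : integralA u (∑ m ∈ F, c m • φ m) t = ∑ m ∈ F, c m * integralA u (φ m) t := by
    simp only [integralA, source_sum, Finset.mul_sum, mul_left_comm (Ai _)]
    exact intFromInfty_sum_const_mul c fun m hm => (hφ m hm).2.1
  have hB : integralB u (∑ m ∈ F, c m • φ m) t = ∑ m ∈ F, c m * integralB u (φ m) t := by
    simp only [integralB, source_sum, Finset.mul_sum, mul_left_comm (Bi _)]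
    exact intFromInfty_sum_const_mul c fun m hm => (hφ m hm).1
  simp only [airyVariation, hA, hB, Finset.mul_sum, mul_sub, Finset.sum_sub_distrib,
    mul_left_comm (c _)]

theorem picardOne_sum (c : ι → ℝ) (hφ : ∀ m ∈ F, IntegralsConverge u t (φ m)) :
    picardOne u (∑ m ∈ F, c m • φ m) t = ∑ m ∈ F, c m * picardOne u (φ m) t := by
  simp only [picardOne, airyVariation_sum _ _ c hφ, Finset.mul_sum, mul_left_comm (c _)]

theorem picardTwo_sum (c : ι → ℝ) (hφ : ∀ m ∈ F, IntegralsConverge u t (φ m)) :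
    picardTwo u (∑ m ∈ F, c m • φ m) t = ∑ m ∈ F, c m * picardTwo u (φ m) t := by
  simp only [picardTwo, airyVariation_sum _ _ c hφ, Finset.mul_sum, mul_left_comm (c _)]

theorem intFromInfty_sourceZero_sum (c : ι → ℝ) (hφ : ∀ m ∈ F, IntegralsConverge u t (φ m)) :
    intFromInfty (sourceZero u ((∑ m ∈ F, c m • φ m) 1) ((∑ m ∈ F, c m • φ m) 2)) t =
      ∑ m ∈ F, c m * intFromInfty (sourceZero u (φ m 1) (φ m 2)) t := by
  rw [funext (sourceZero_sum c)]
  exact intFromInfty_sum_const_mul c fun m hm => (hφ m hm).2.2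

theorem airyVariation_zero (a b u : ℝ → ℝ) (t : ℝ) : airyVariation a b u 0 t = 0 := by
  simp [airyVariation, integralA, integralB, source, intFromInfty]

theorem picardOne_zero (u : ℝ → ℝ) (t : ℝ) : picardOne u 0 t = 0 := by
  rw [picardOne, airyVariation_zero, mul_zero]

theorem picardTwo_zero (u : ℝ → ℝ) (t : ℝ) : picardTwo u 0 t = 0 := by
  rw [picardTwo, airyVariation_zero, mul_zero]

theorem intFromInfty_sourceZero_zero (u : ℝ → ℝ) (t : ℝ) :
    intFromInfty (sourceZero u 0 0) t = 0 := by
  simp [intFromInfty, sourceZero]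

end Linearity

section Regularity

theorem continuousOn_airyVariation {a b : ℝ → ℝ} (ha : Continuous a) (hb : Continuous b)
    (hφ : IntegralsConverge u T φ) : ContinuousOn (airyVariation a b u φ) (Ici T) :=
  ((ha.comp continuous_sc).continuousOn.mul (continuousOn_intFromInfty hφ.1)).sub
    ((hb.comp continuous_sc).continuousOn.mul (continuousOn_intFromInfty hφ.2.1))

theorem continuousOn_picardOne (hφ : IntegralsConverge u T φ) :
    ContinuousOn (picardOne u φ) (Ici T) :=
  continuousOn_const.mul (continuousOn_airyVariation continuous_Ai continuous_Bi hφ)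

theorem continuousOn_picardTwo (hφ : IntegralsConverge u T φ) :
    ContinuousOn (picardTwo u φ) (Ici T) :=
  continuousOn_const.mul (continuousOn_airyVariation continuous_deriv_Ai continuous_deriv_Bi hφ)

theorem hasDerivWithinAt_airyVariation {a b : ℝ → ℝ} {a' b' : ℝ} (ha : HasDerivAt a a' (sc t))
    (hb : HasDerivAt b b' (sc t)) (hφ : IntegralsConverge u T φ)
    (hc : ContinuousOn (source u φ) (Ici T)) (ht : T ≤ t) :
    HasDerivWithinAt (airyVariation a b u φ)
      (1 / cbrtThree ^ 2 * (a' * integralB u φ t - b' * integralA u φ t) +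
        (a (sc t) * Bi (sc t) - b (sc t) * Ai (sc t)) * source u φ t) (Ici T) t := by
  have hA := hasDerivWithinAt_intFromInfty hφ.2.1
    ((continuous_Ai.comp continuous_sc).continuousOn.mul hc) ht
  have hB := hasDerivWithinAt_intFromInfty hφ.1
    ((continuous_Bi.comp continuous_sc).continuousOn.mul hc) ht
  convert! ((ha.comp t (hasDerivAt_sc t)).hasDerivWithinAt.mul hB).sub
    ((hb.comp t (hasDerivAt_sc t)).hasDerivWithinAt.mul hA) using 1
  simp only [integralA, integralB, Function.comp_apply]
  ring

theorem hasDerivWithinAt_picardOne (hφ : IntegralsConverge u T φ)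
    (hc : ContinuousOn (source u φ) (Ici T)) (ht : T ≤ t) :
    HasDerivWithinAt (picardOne u φ) (-(2 / 3) * picardTwo u φ t) (Ici T) t := by
  convert! (hasDerivWithinAt_airyVariation (hasDerivAt_Ai _) (hasDerivAt_Bi _) hφ hc ht).const_mul
    (2 * Real.pi / cbrtThree) using 1
  have := cbrtThree_pos
  rw [picardTwo, airyVariation]
  field_simp
  linear_combination (deriv Ai (sc t) * integralB u φ t - deriv Bi (sc t) * integralA u φ t) *
    cbrtThree_pow_three

-- The Wronskian `Ai Bi' - Ai' Bi = π⁻¹` turns the boundary terms into the source.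
theorem hasDerivWithinAt_picardTwo (hφ : IntegralsConverge u T φ)
    (hc : ContinuousOn (source u φ) (Ici T)) (ht : T ≤ t) :
    HasDerivWithinAt (picardTwo u φ) (source u φ t - 1 / 6 * t * picardOne u φ t) (Ici T) t := by
  convert! (hasDerivWithinAt_airyVariation (hasDerivAt_deriv_Ai _) (hasDerivAt_deriv_Bi _)
    hφ hc ht).const_mul (-Real.pi) using 1
  have hw : Real.pi * (Ai (sc t) * deriv Bi (sc t) - deriv Ai (sc t) * Bi (sc t)) = 1 := by
    rw [wronskian, mul_inv_cancel₀ Real.pi_ne_zero]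
  have hsc : 1 / cbrtThree ^ 2 * sc t = t / (3 * cbrtThree) := by
    have := cbrtThree_pos
    rw [sc_eq_div, ← cbrtThree_pow_three]
    field_simp
  rw [picardOne, airyVariation]
  linear_combination -source u φ t * hw +
    Real.pi * (Ai (sc t) * integralB u φ t - Bi (sc t) * integralA u φ t) * hsc

end Regularity

end PicardOperator

section DecayBounds

/-- Measurable triples with `|φ₁| ≤ c₁ exp (-a t^{3/2})`, `|φ₂| ≤ (c₁ / 2) √t exp (-a t^{3/2})` and
`|φ₀| ≤ c₀ exp (-b t^{3/2})` on `[T, ∞)`, the common shape of all estimates on the iterates. -/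
structure DecayBounds (T a b c₁ c₀ : ℝ) (φ : Fin 3 → ℝ → ℝ) : Prop where
  meas : ∀ i, AEStronglyMeasurable (φ i) (volume.restrict (Ioi T))
  one : ∀ t, T ≤ t → |φ 1 t| ≤ c₁ * expDecay a t
  two : ∀ t, T ≤ t → |φ 2 t| ≤ c₁ / 2 * (√t * expDecay a t)
  zero : ∀ t, T ≤ t → |φ 0 t| ≤ c₀ * expDecay b t

variable {u : ℝ → ℝ} {φ ψ : Fin 3 → ℝ → ℝ} {T t a b c c₁ c₀ d : ℝ}

theorem aestronglyMeasurable_of_continuousOn_Ici {f : ℝ → ℝ} (hf : ContinuousOn f (Ici T)) :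
    AEStronglyMeasurable f (volume.restrict (Ioi T)) :=
  (hf.mono Ioi_subset_Ici_self).aestronglyMeasurable measurableSet_Ioi

theorem DecayBounds.one_const_nonneg (hφ : DecayBounds T a b c₁ c₀ φ) : 0 ≤ c₁ :=
  nonneg_of_mul_nonneg_left ((abs_nonneg _).trans (hφ.one T le_rfl)) (expDecay_pos a T)

theorem DecayBounds.zero_const_nonneg (hφ : DecayBounds T a b c₁ c₀ φ) : 0 ≤ c₀ :=
  nonneg_of_mul_nonneg_left ((abs_nonneg _).trans (hφ.zero T le_rfl)) (expDecay_pos b T)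

theorem DecayBounds.mono_left (hφ : DecayBounds T a b c₁ c₀ φ) (ht : T ≤ t) :
    DecayBounds t a b c₁ c₀ φ where
  meas i := (hφ.meas i).mono_measure (Measure.restrict_mono (Ioi_subset_Ioi ht) le_rfl)
  one s hs := hφ.one s (ht.trans hs)
  two s hs := hφ.two s (ht.trans hs)
  zero s hs := hφ.zero s (ht.trans hs)

theorem DecayBounds.mono_const {c₁' c₀' : ℝ} (hφ : DecayBounds T a b c₁ c₀ φ) (h₁ : c₁ ≤ c₁')
    (h₀ : c₀ ≤ c₀') : DecayBounds T a b c₁' c₀' φ where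
  meas := hφ.meas
  one t ht := (hφ.one t ht).trans (mul_le_mul_of_nonneg_right h₁ (expDecay_pos a t).le)
  two t ht := (hφ.two t ht).trans (mul_le_mul_of_nonneg_right (by linarith)
    (mul_nonneg (Real.sqrt_nonneg t) (expDecay_pos a t).le))
  zero t ht := (hφ.zero t ht).trans (mul_le_mul_of_nonneg_right h₀ (expDecay_pos b t).le)

theorem DecayBounds.congr (hφ : DecayBounds T a b c₁ c₀ φ) (h : ∀ i t, T ≤ t → φ i t = ψ i t) :
    DecayBounds T a b c₁ c₀ ψ where
  meas i := (hφ.meas i).congr <|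
    (ae_restrict_iff' measurableSet_Ioi).2 (ae_of_all _ fun t (ht : T < t) => h i t ht.le)
  one t ht := h 1 t ht ▸ hφ.one t ht
  two t ht := h 2 t ht ▸ hφ.two t ht
  zero t ht := h 0 t ht ▸ hφ.zero t ht

theorem DecayBounds.sum {ι : Type*} {F : Finset ι} {φ : ι → Fin 3 → ℝ → ℝ} {c₁ c₀ : ι → ℝ}
    (hφ : ∀ m ∈ F, DecayBounds T a b (c₁ m) (c₀ m) (φ m)) :
    DecayBounds T a b (∑ m ∈ F, c₁ m) (∑ m ∈ F, c₀ m) (fun i t => ∑ m ∈ F, φ m i t) where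
  meas i := Finset.aestronglyMeasurable_fun_sum F fun m hm => (hφ m hm).meas i
  one t ht := by
    rw [Finset.sum_mul]
    exact norm_sum_le_of_le F (f := fun m => φ m 1 t) fun m hm => (hφ m hm).one t ht
  two t ht := by
    rw [Finset.sum_div, Finset.sum_mul]
    exact norm_sum_le_of_le F (f := fun m => φ m 2 t) fun m hm => (hφ m hm).two t ht
  zero t ht := by
    rw [Finset.sum_mul]
    exact norm_sum_le_of_le F (f := fun m => φ m 0 t) fun m hm => (hφ m hm).zero t ht

theorem DecayBounds.of_tendsto {φ : ℕ → Fin 3 → ℝ → ℝ} (hφ : ∀ n, DecayBounds T a b c₁ c₀ (φ n))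
    (hlim : ∀ i t, T ≤ t → Tendsto (fun n => φ n i t) atTop (𝓝 (ψ i t))) :
    DecayBounds T a b c₁ c₀ ψ where
  meas i := aestronglyMeasurable_of_tendsto_ae atTop (fun n => (hφ n).meas i) <|
    (ae_restrict_iff' measurableSet_Ioi).2 (ae_of_all _ fun t (ht : T < t) => hlim i t ht.le)
  one t ht := le_of_tendsto' (hlim 1 t ht).abs fun n => (hφ n).one t ht
  two t ht := le_of_tendsto' (hlim 2 t ht).abs fun n => (hφ n).two t ht
  zero t ht := le_of_tendsto' (hlim 0 t ht).abs fun n => (hφ n).zero t ht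

theorem aestronglyMeasurable_source {s : Set ℝ} (hu : Continuous u)
    (hφ : ∀ i, AEStronglyMeasurable (φ i) (volume.restrict s)) :
    AEStronglyMeasurable (source u φ) (volume.restrict s) :=
  ((hu.aestronglyMeasurable.const_mul _).mul (hφ 0)).sub
    (((hu.aestronglyMeasurable.pow 2).const_mul _).mul (hφ 1))

theorem aestronglyMeasurable_sourceZero {s : Set ℝ} (hu : ContDiff ℝ 1 u) {φ₁ φ₂ : ℝ → ℝ}
    (hφ₁ : AEStronglyMeasurable φ₁ (volume.restrict s))
    (hφ₂ : AEStronglyMeasurable φ₂ (volume.restrict s)) :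
    AEStronglyMeasurable (sourceZero u φ₁ φ₂) (volume.restrict s) :=
  (((hu.continuous_deriv le_rfl).aestronglyMeasurable.const_mul _).mul hφ₁).sub
    ((hu.continuous.aestronglyMeasurable.const_mul _).mul hφ₂)

theorem DecayBounds.abs_source_le (hφ : DecayBounds T a b c₁ c₀ φ) (h : IsThreshold u T)
    (hda : d ≤ a + 4 / 3) (hdb : d ≤ b + 2 / 3) (ht : T ≤ t) :
    |source u φ t| ≤ (2 / 3 * c₀ + 1 / 3 * c₁) * expDecay d t := by
  have hzero : |u t| * |φ 0 t| ≤ c₀ * expDecay d t :=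
    calc |u t| * |φ 0 t| ≤ expDecay (2 / 3) t * (c₀ * expDecay b t) :=
          mul_le_mul (h.abs_u_lt ht).le (hφ.zero t ht) (abs_nonneg _) (expDecay_pos _ _).le
      _ = c₀ * expDecay (b + 2 / 3) t := by rw [expDecay_add]; ring
      _ ≤ c₀ * expDecay d t := mul_le_mul_of_nonneg_left (expDecay_anti hdb (h.nonneg_of_le ht))
          hφ.zero_const_nonneg
  have hone : |u t| ^ 2 * |φ 1 t| ≤ c₁ * expDecay d t :=
    calc |u t| ^ 2 * |φ 1 t| ≤ expDecay (2 / 3) t ^ 2 * (c₁ * expDecay a t) :=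
          mul_le_mul (pow_le_pow_left₀ (abs_nonneg _) (h.abs_u_lt ht).le 2) (hφ.one t ht)
            (abs_nonneg _) (sq_nonneg _)
      _ = c₁ * expDecay (a + 4 / 3) t := by
          rw [show a + 4 / 3 = a + (2 / 3 + 2 / 3) by ring, expDecay_add, expDecay_add]
          ring
      _ ≤ c₁ * expDecay d t := mul_le_mul_of_nonneg_left (expDecay_anti hda (h.nonneg_of_le ht))
          hφ.one_const_nonneg
  calc |source u φ t| ≤ |-(2 / 3) * u t * φ 0 t| + |1 / 3 * u t ^ 2 * φ 1 t| := abs_sub _ _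
    _ = 2 / 3 * (|u t| * |φ 0 t|) + 1 / 3 * (|u t| ^ 2 * |φ 1 t|) := by
        simp only [abs_mul, abs_neg, abs_pow, abs_of_pos (show (0 : ℝ) < 2 / 3 by norm_num),
          abs_of_pos (show (0 : ℝ) < 1 / 3 by norm_num), mul_assoc]
    _ ≤ (2 / 3 * c₀ + 1 / 3 * c₁) * expDecay d t := by linarith

theorem abs_sourceZero_le_add (u φ₁ φ₂ : ℝ → ℝ) (t : ℝ) :
    |sourceZero u φ₁ φ₂ t| ≤ 1 / 3 * (|deriv u t| * |φ₁ t|) + 2 / 3 * (|u t| * |φ₂ t|) := by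
  refine (abs_sub _ _).trans_eq ?_
  simp only [abs_mul, abs_of_pos (show (0 : ℝ) < 2 / 3 by norm_num),
    abs_of_pos (show (0 : ℝ) < 1 / 3 by norm_num), mul_assoc]

theorem abs_sourceZero_le (h : IsThreshold u T) {φ₁ φ₂ : ℝ → ℝ} (ht : T ≤ t)
    (h₁ : |φ₁ t| ≤ c * expDecay a t) (h₂ : |φ₂ t| ≤ c / 2 * (√t * expDecay a t)) :
    |sourceZero u φ₁ φ₂ t| ≤ 2 / 3 * c * (√t * expDecay (a + 2 / 3) t) := by
  have hone := mul_le_mul (h.abs_deriv_u_lt ht).le h₁ (abs_nonneg _)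
    (mul_nonneg (Real.sqrt_nonneg t) (expDecay_pos (2 / 3) t).le)
  have htwo := mul_le_mul (h.abs_u_lt ht).le h₂ (abs_nonneg _) (expDecay_pos (2 / 3) t).le
  rw [expDecay_add]
  linarith [abs_sourceZero_le_add u φ₁ φ₂ t]

theorem abs_sourceZero_lt (h : IsThreshold u T) {φ₁ φ₂ : ℝ → ℝ} (ht : T ≤ t)
    (h₁ : |φ₁ t| < c * expDecay a t) (h₂ : |φ₂ t| < c / 2 * (√t * expDecay a t)) :
    |sourceZero u φ₁ φ₂ t| < 2 / 3 * c * (√t * expDecay (a + 2 / 3) t) := by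
  have hone := mul_lt_mul'' (h.abs_deriv_u_lt ht) h₁ (abs_nonneg _) (abs_nonneg _)
  have htwo := mul_lt_mul'' (h.abs_u_lt ht) h₂ (abs_nonneg _) (abs_nonneg _)
  rw [expDecay_add]
  linarith [abs_sourceZero_le_add u φ₁ φ₂ t]

theorem IsThreshold.one_le_sqrt (h : IsThreshold u T) (ht : T ≤ t) : 1 ≤ √t :=
  Real.one_le_sqrt.2 (h.one_le.trans ht)

theorem abs_Ai_mul_le (h : IsThreshold u T) {y : ℝ} (hc : 0 ≤ c) (ht : T ≤ t)
    (hy : |y| ≤ c * expDecay d t) : |Ai (sc t) * y| ≤ c * (√t * expDecay (d + 2 / 9) t) :=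
  calc |Ai (sc t) * y| ≤ expDecay (2 / 9) t * (c * expDecay d t) := by
        rw [abs_mul]
        exact mul_le_mul (h.abs_Ai_lt ht).le hy (abs_nonneg _) (expDecay_pos _ _).le
    _ = c * (1 * expDecay (d + 2 / 9) t) := by rw [expDecay_add]; ring
    _ ≤ c * (√t * expDecay (d + 2 / 9) t) := by
        have := h.one_le_sqrt ht
        have := expDecay_pos (d + 2 / 9) t
        gcongr

theorem abs_Bi_mul_le (h : IsThreshold u T) {y : ℝ} (hc : 0 ≤ c) (ht : T ≤ t)
    (hy : |y| ≤ c * expDecay d t) : |Bi (sc t) * y| ≤ c * (√t * expDecay (d - 2 / 9) t) :=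
  calc |Bi (sc t) * y| ≤ expDecay (-(2 / 9)) t * (c * expDecay d t) := by
        rw [abs_mul]
        exact mul_le_mul (h.abs_Bi_lt ht).le hy (abs_nonneg _) (expDecay_pos _ _).le
    _ = c * (1 * expDecay (d - 2 / 9) t) := by rw [sub_eq_add_neg, expDecay_add]; ring
    _ ≤ c * (√t * expDecay (d - 2 / 9) t) := by
        have := h.one_le_sqrt ht
        have := expDecay_pos (d - 2 / 9) t
        gcongr

theorem abs_airyVariation_lt (h : IsThreshold u T) {x y : ℝ → ℝ} {w : ℝ} (hc : 0 < c)
    (hd : 2 / 9 < d) (hs : ∀ s, T ≤ s → |source u φ s| ≤ c * expDecay d s) (ht : T ≤ t)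
    (hx : |x (sc t)| < w * expDecay (2 / 9) t) (hy : |y (sc t)| < w * expDecay (-(2 / 9)) t) :
    |airyVariation x y u φ t| <
      w * (c * (2 / 3 / (d - 2 / 9)) + c * (2 / 3 / (d + 2 / 9))) * expDecay d t := by
  have hd_sub : 0 < d - 2 / 9 := by linarith
  have hd_add : 0 < d + 2 / 9 := by linarith
  have hA : |integralA u φ t| ≤ c * (2 / 3 / (d + 2 / 9)) * expDecay (d + 2 / 9) t :=
    abs_intFromInfty_le hd_add fun s hts =>
      abs_Ai_mul_le h hc.le (ht.trans hts) (hs s (ht.trans hts))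
  have hB : |integralB u φ t| ≤ c * (2 / 3 / (d - 2 / 9)) * expDecay (d - 2 / 9) t :=
    abs_intFromInfty_le hd_sub fun s hts =>
      abs_Bi_mul_le h hc.le (ht.trans hts) (hs s (ht.trans hts))
  have hsub : expDecay (2 / 9) t * expDecay (d - 2 / 9) t = expDecay d t := by
    rw [← expDecay_add, add_sub_cancel]
  have hadd : expDecay (-(2 / 9)) t * expDecay (d + 2 / 9) t = expDecay d t := by
    rw [← expDecay_add, add_comm, add_neg_cancel_right]
  calc |airyVariation x y u φ t|
      ≤ |x (sc t)| * |integralB u φ t| + |y (sc t)| * |integralA u φ t| := by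
        rw [← abs_mul, ← abs_mul]
        exact abs_sub _ _
    _ < w * expDecay (2 / 9) t * (c * (2 / 3 / (d - 2 / 9)) * expDecay (d - 2 / 9) t) +
        w * expDecay (-(2 / 9)) t * (c * (2 / 3 / (d + 2 / 9)) * expDecay (d + 2 / 9) t) :=
        add_lt_add
          (mul_lt_mul_of_lt_of_le_of_nonneg_of_pos hx hB (abs_nonneg _)
            (mul_pos (by positivity) (expDecay_pos _ t)))
          (mul_lt_mul_of_lt_of_le_of_nonneg_of_pos hy hA (abs_nonneg _)
            (mul_pos (by positivity) (expDecay_pos _ t)))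
    _ = w * (c * (2 / 3 / (d - 2 / 9)) + c * (2 / 3 / (d + 2 / 9))) * expDecay d t := by
        linear_combination w * c * (2 / 3 / (d - 2 / 9)) * hsub +
          w * c * (2 / 3 / (d + 2 / 9)) * hadd

theorem integrableOn_sourceZero (hu : ContDiff ℝ 1 u) (h : IsThreshold u T) {φ₁ φ₂ : ℝ → ℝ}
    (ha : -(2 / 3) < a) (hφ₁ : AEStronglyMeasurable φ₁ (volume.restrict (Ioi T)))
    (hφ₂ : AEStronglyMeasurable φ₂ (volume.restrict (Ioi T)))
    (h₁ : ∀ t, T ≤ t → |φ₁ t| ≤ c * expDecay a t)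
    (h₂ : ∀ t, T ≤ t → |φ₂ t| ≤ c / 2 * (√t * expDecay a t)) :
    IntegrableOn (sourceZero u φ₁ φ₂) (Ioi T) :=
  integrableOn_of_le_sqrt_mul_expDecay (by linarith : 0 < a + 2 / 3)
    (aestronglyMeasurable_sourceZero hu hφ₁ hφ₂)
    fun s hs => abs_sourceZero_le h hs (h₁ s hs) (h₂ s hs)

theorem exists_source_rate (ha : -(2 / 3) < a) (hb : -(4 / 9) < b) :
    ∃ d, 2 / 9 < d ∧ d ≤ a + 4 / 3 ∧ d ≤ b + 2 / 3 :=
  ⟨_, lt_min (by linarith) (by linarith), min_le_left _ _, min_le_right _ _⟩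

theorem DecayBounds.integralsConverge (hφ : DecayBounds T a b c₁ c₀ φ) (hu : ContDiff ℝ 1 u)
    (h : IsThreshold u T) (ha : -(2 / 3) < a) (hb : -(4 / 9) < b) : IntegralsConverge u T φ := by
  obtain ⟨d, hd, hda, hdb⟩ := exists_source_rate ha hb
  have hm := aestronglyMeasurable_source hu.continuous hφ.meas
  have hc : 0 ≤ 2 / 3 * c₀ + 1 / 3 * c₁ := by
    linarith [hφ.one_const_nonneg, hφ.zero_const_nonneg]
  exact ⟨integrableOn_of_le_sqrt_mul_expDecay (sub_pos.2 hd)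
      ((continuous_Bi.comp continuous_sc).aestronglyMeasurable.mul hm)
      fun s hs => abs_Bi_mul_le h hc hs (hφ.abs_source_le h hda hdb hs),
    integrableOn_of_le_sqrt_mul_expDecay (by linarith : 0 < d + 2 / 9)
      ((continuous_Ai.comp continuous_sc).aestronglyMeasurable.mul hm)
      fun s hs => abs_Ai_mul_le h hc hs (hφ.abs_source_le h hda hdb hs),
    integrableOn_sourceZero hu h ha (hφ.meas 1) (hφ.meas 2) hφ.one hφ.two⟩

section Convergence

variable {φ : ℕ → Fin 3 → ℝ → ℝ}

theorem tendsto_source {s : ℝ} (hlim : ∀ i, Tendsto (fun n => φ n i s) atTop (𝓝 (ψ i s))) :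
    Tendsto (fun n => source u (φ n) s) atTop (𝓝 (source u ψ s)) :=
  ((hlim 0).const_mul _).sub ((hlim 1).const_mul _)

theorem tendsto_airyVariation (x y : ℝ → ℝ) (hu : Continuous u) (h : IsThreshold u T)
    (ha : -(2 / 3) < a) (hb : -(4 / 9) < b) (hφ : ∀ n, DecayBounds T a b c₁ c₀ (φ n))
    (hlim : ∀ i t, T ≤ t → Tendsto (fun n => φ n i t) atTop (𝓝 (ψ i t))) (ht : T ≤ t) :
    Tendsto (fun n => airyVariation x y u (φ n) t) atTop (𝓝 (airyVariation x y u ψ t)) := by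
  obtain ⟨d, hd, hda, hdb⟩ := exists_source_rate ha hb
  have hm n := aestronglyMeasurable_source hu ((hφ n).mono_left ht).meas
  have hc : 0 ≤ 2 / 3 * c₀ + 1 / 3 * c₁ := by
    linarith [(hφ 0).one_const_nonneg, (hφ 0).zero_const_nonneg]
  have hsource n s (hts : t ≤ s) := (hφ n).abs_source_le h hda hdb (ht.trans hts)
  have hsource_lim s (hts : t ≤ s) := tendsto_source (u := u) fun i => hlim i s (ht.trans hts)
  have hA : Tendsto (fun n => integralA u (φ n) t) atTop (𝓝 (integralA u ψ t)) :=
    tendsto_intFromInfty (by linarith : 0 < d + 2 / 9)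
      (fun n => (continuous_Ai.comp continuous_sc).aestronglyMeasurable.mul (hm n))
      (fun n s hts => abs_Ai_mul_le h hc (ht.trans hts) (hsource n s hts))
      fun s hts => (hsource_lim s hts).const_mul _
  have hB : Tendsto (fun n => integralB u (φ n) t) atTop (𝓝 (integralB u ψ t)) :=
    tendsto_intFromInfty (sub_pos.2 hd)
      (fun n => (continuous_Bi.comp continuous_sc).aestronglyMeasurable.mul (hm n))
      (fun n s hts => abs_Bi_mul_le h hc (ht.trans hts) (hsource n s hts))
      fun s hts => (hsource_lim s hts).const_mul _
  exact (hB.const_mul _).sub (hA.const_mul _)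

theorem tendsto_intFromInfty_sourceZero (hu : ContDiff ℝ 1 u) (h : IsThreshold u T)
    (ha : -(2 / 3) < a) (hφ : ∀ n, DecayBounds T a b c₁ c₀ (φ n))
    (hlim : ∀ i t, T ≤ t → Tendsto (fun n => φ n i t) atTop (𝓝 (ψ i t))) (ht : T ≤ t) :
    Tendsto (fun n => intFromInfty (sourceZero u (φ n 1) (φ n 2)) t) atTop
      (𝓝 (intFromInfty (sourceZero u (ψ 1) (ψ 2)) t)) :=
  tendsto_intFromInfty (by linarith : 0 < a + 2 / 3)
    (fun n => aestronglyMeasurable_sourceZero hu (((hφ n).mono_left ht).meas 1)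
      (((hφ n).mono_left ht).meas 2))
    (fun n s hts => abs_sourceZero_le h (ht.trans hts) ((hφ n).one s (ht.trans hts))
      ((hφ n).two s (ht.trans hts)))
    fun s hts => ((hlim 1 s (ht.trans hts)).const_mul _).sub
      ((hlim 2 s (ht.trans hts)).const_mul _)

end Convergence

end DecayBounds

section Increments

/-- The decay rate of the component `φ₀` of the `j`-th increment of the Picard iteration; the other
two components decay at the rate `rate k j - 2 / 3`. -/
def rate (k : Fin 3) (j : ℕ) : ℝ := 4 / 9 * (3 * j + (k : ℕ))

/-- The increments of the Picard iteration, the zeroth one being the initial iterate. -/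
def increment (u : ℝ → ℝ) (k : Fin 3) (j : ℕ) : Fin 3 → ℝ → ℝ :=
  (picard u)^[j] (iterate u k 0)

variable {u : ℝ → ℝ} {φ : Fin 3 → ℝ → ℝ} {T t : ℝ} {k : Fin 3} {j : ℕ}

theorem increment_succ (u : ℝ → ℝ) (k : Fin 3) (j : ℕ) :
    increment u k (j + 1) = picard u (increment u k j) :=
  Function.iterate_succ_apply' _ _ _

theorem rate_succ (k : Fin 3) (j : ℕ) : rate k (j + 1) = rate k j + 2 / 3 + 2 / 3 := by
  rw [rate, rate]
  push_cast
  ring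

theorem boundOne_succ_eq_of_source (k : Fin 3) (j : ℕ) :
    2 * Real.pi / cbrtThree *
      ((2 / 3 * C₀ k j + 1 / 3 * boundOne k j) * (2 / 3 / (rate k j + 2 / 3 - 2 / 9)) +
        (2 / 3 * C₀ k j + 1 / 3 * boundOne k j) * (2 / 3 / (rate k j + 2 / 3 + 2 / 9))) =
      boundOne k (j + 1) := by
  have := cbrtThree_pos
  rw [boundOne_succ, boundOne, rate]
  set n : ℝ := 3 * j + (k : ℕ)
  have hn0 : 0 ≤ n := by positivity
  rw [show 4 / 9 * n + 2 / 3 - 2 / 9 = 4 / 9 * (n + 1) by ring,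
    show 4 / 9 * n + 2 / 3 + 2 / 9 = 4 / 9 * (n + 2) by ring]
  field_simp
  ring

theorem boundOne_eq_rate_mul (k : Fin 3) (j : ℕ) : boundOne k j = 9 / 4 * rate k j * C₀ k j := by
  rw [boundOne, rate]
  ring

theorem boundOne_mul_div_rate (h : 0 < rate k j) :
    2 / 3 * boundOne k j * (2 / 3 / rate k j) = C₀ k j := by
  rw [boundOne_eq_rate_mul]
  field_simp
  norm_num

theorem boundOne_mul_expDecay_le (k : Fin 3) (j : ℕ) (ht : 0 ≤ t) :
    boundOne k j * expDecay (rate k j - 2 / 3) t ≤ boundOne k j * expDecay (-(2 / 9)) t := by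
  obtain hn | hn := (3 * j + (k : ℕ)).eq_zero_or_pos
  · have hzero : boundOne k j = 0 := by
      rw [boundOne, show (3 * j + (k : ℕ) : ℝ) = 0 by exact_mod_cast hn, zero_mul]
    rw [hzero, zero_mul, zero_mul]
  · have hn : (1 : ℝ) ≤ 3 * j + (k : ℕ) := by exact_mod_cast hn
    refine mul_le_mul_of_nonneg_left (expDecay_anti ?_ ht) (boundOne_nonneg k j)
    rw [rate]
    linarith

theorem rate_nonneg (k : Fin 3) (j : ℕ) : 0 ≤ rate k j := by
  rw [rate]
  positivity

theorem rate_pos_of_ne_zero (hk : k ≠ 0) (j : ℕ) : 0 < rate k j := by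
  have : 0 < (k : ℕ) := Nat.pos_of_ne_zero (Fin.val_ne_zero_iff.2 hk)
  rw [rate]
  positivity

/-- The bounds satisfied by the `j`-th increment. -/
abbrev IncrementBounds (T : ℝ) (k : Fin 3) (j : ℕ) : (Fin 3 → ℝ → ℝ) → Prop :=
  DecayBounds T (rate k j - 2 / 3) (rate k j) (boundOne k j) (C₀ k j)

theorem IncrementBounds.decayBounds (h : IsThreshold u T) (hφ : IncrementBounds T k j φ) :
    DecayBounds T (-(2 / 9)) 0 (boundOne k j) (C₀ k j) φ where
  meas := hφ.meas
  one t ht := (hφ.one t ht).trans (boundOne_mul_expDecay_le k j (h.nonneg_of_le ht))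
  two t ht := (hφ.two t ht).trans <| by
    linarith [mul_le_mul_of_nonneg_left (boundOne_mul_expDecay_le k j (h.nonneg_of_le ht))
      (Real.sqrt_nonneg t)]
  zero t ht := (hφ.zero t ht).trans (mul_le_mul_of_nonneg_left
    (expDecay_anti (rate_nonneg k j) (h.nonneg_of_le ht)) (C₀_pos k j).le)

theorem IncrementBounds.integralsConverge (hu : ContDiff ℝ 1 u) (h : IsThreshold u T)
    (hφ : IncrementBounds T k j φ) : IntegralsConverge u T φ :=
  (hφ.decayBounds h).integralsConverge hu h (by norm_num) (by norm_num)

section Initial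

theorem increment_zero_one (u : ℝ → ℝ) : ∀ k, increment u k 0 1 = g k
  | 0 => by funext t; simp [increment, iterate, g]
  | 1 => by funext t; simp [increment, iterate, delta]
  | 2 => by funext t; simp [increment, iterate, delta]

theorem increment_zero_two (u : ℝ → ℝ) : ∀ k,
    increment u k 0 2 = fun t => -(3 / 2) * deriv (g k) t
  | 0 => by funext t; simp [increment, iterate, (hasDerivAt_g_zero t).deriv]
  | 1 => by funext t; simp [increment, iterate, delta]
  | 2 => by funext t; simp [increment, iterate, delta]

theorem increment_zero_zero (u : ℝ → ℝ) (k : Fin 3) (t : ℝ) : increment u k 0 0 t =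
    delta k + intFromInfty (sourceZero u (increment u k 0 1) (increment u k 0 2)) t := rfl

theorem boundOne_zero_zero : boundOne 0 0 = 0 := by simp [boundOne]

theorem boundOne_one_zero : boundOne 1 0 = 1 := by simp [boundOne, C₀]

theorem boundOne_two_zero : boundOne 2 0 = 1 := by simp [boundOne, C₀]

theorem rate_one_zero_sub : rate 1 0 - 2 / 3 = -(2 / 9) := by norm_num [rate]

theorem rate_two_zero_sub : rate 2 0 - 2 / 3 = 2 / 9 := by norm_num [rate]

theorem abs_g_le (h : IsThreshold u T) (ht : T ≤ t) : ∀ k,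
    |g k t| ≤ boundOne k 0 * expDecay (rate k 0 - 2 / 3) t
  | 0 => by rw [boundOne_zero_zero, zero_mul]; exact abs_zero.le
  | 1 => by rw [boundOne_one_zero, rate_one_zero_sub, one_mul]; exact (h.abs_Bi_lt ht).le
  | 2 => by rw [boundOne_two_zero, rate_two_zero_sub, one_mul]; exact (h.abs_Ai_lt ht).le

theorem abs_three_halves_mul_deriv_le {y E : ℝ} (hy : |y| ≤ √t / cbrtThree * E) :
    |-(3 / 2) * (y * (1 / cbrtThree ^ 2))| ≤ 1 / 2 * (√t * E) := by
  have := cbrtThree_pos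
  calc |-(3 / 2) * (y * (1 / cbrtThree ^ 2))| = 3 / 2 / cbrtThree ^ 2 * |y| := by
        rw [show -(3 / 2) * (y * (1 / cbrtThree ^ 2)) = -(3 / 2 / cbrtThree ^ 2) * y by ring,
          abs_mul, abs_neg, abs_of_pos (by positivity)]
    _ ≤ 3 / 2 / cbrtThree ^ 2 * (√t / cbrtThree * E) := by gcongr
    _ = 3 / 2 / cbrtThree ^ 3 * (√t * E) := by field_simp
    _ = 1 / 2 * (√t * E) := by rw [cbrtThree_pow_three]; ring

theorem abs_deriv_g_le (h : IsThreshold u T) (ht : T ≤ t) : ∀ k,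
    |-(3 / 2) * deriv (g k) t| ≤ boundOne k 0 / 2 * (√t * expDecay (rate k 0 - 2 / 3) t)
  | 0 => by simp [boundOne_zero_zero, (hasDerivAt_g_zero t).deriv]
  | 1 => by
    rw [boundOne_one_zero, rate_one_zero_sub, (hasDerivAt_g_one t).deriv]
    exact abs_three_halves_mul_deriv_le (h.abs_deriv_Bi_lt ht).le
  | 2 => by
    rw [boundOne_two_zero, rate_two_zero_sub, (hasDerivAt_g_two t).deriv]
    exact abs_three_halves_mul_deriv_le (h.abs_deriv_Ai_lt ht).le

theorem abs_increment_zero_zero_le_of_ne (h : IsThreshold u T) (hk : k ≠ 0) (ht : T ≤ t) :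
    |increment u k 0 0 t| ≤ C₀ k 0 * expDecay (rate k 0) t := by
  have hrate := rate_pos_of_ne_zero hk 0
  rw [increment_zero_zero, delta, if_neg hk, zero_add, ← boundOne_mul_div_rate hrate,
    increment_zero_one, increment_zero_two]
  refine abs_intFromInfty_le hrate fun s hs => ?_
  simpa only [sub_add_cancel] using
    abs_sourceZero_le h (ht.trans hs) (abs_g_le h (ht.trans hs) k)
      (abs_deriv_g_le h (ht.trans hs) k)

theorem increment_zero_zero_zero (u : ℝ → ℝ) (t : ℝ) : increment u 0 0 0 t = 1 := by
  have hsource : ∀ s, sourceZero u (increment u 0 0 1) (increment u 0 0 2) s = 0 := fun s => by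
    simp [sourceZero, increment_zero_one, increment_zero_two, g]
  simp [increment_zero_zero, funext hsource, intFromInfty, delta]

theorem abs_increment_zero_zero_le (h : IsThreshold u T) (k : Fin 3) (ht : T ≤ t) :
    |increment u k 0 0 t| ≤ C₀ k 0 * expDecay (rate k 0) t := by
  obtain rfl | hk := eq_or_ne k 0
  · rw [increment_zero_zero_zero]
    simp [C₀, rate, expDecay]
  · exact abs_increment_zero_zero_le_of_ne h hk ht

theorem continuous_increment_zero_one (u : ℝ → ℝ) (k : Fin 3) :
    Continuous (increment u k 0 1) := by
  rw [increment_zero_one]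
  exact continuous_g k

theorem continuous_increment_zero_two (u : ℝ → ℝ) (k : Fin 3) :
    Continuous (increment u k 0 2) := by
  rw [increment_zero_two]
  exact continuous_const.mul (continuous_deriv_g k)

theorem continuousOn_increment_zero_zero (hu : ContDiff ℝ 1 u) (h : IsThreshold u T) (k : Fin 3) :
    ContinuousOn (increment u k 0 0) (Ici T) := by
  obtain rfl | hk := eq_or_ne k 0
  · rw [funext (increment_zero_zero_zero u)]
    exact continuousOn_const
  · have hrate : -(2 / 3) < rate k 0 - 2 / 3 := by linarith [rate_pos_of_ne_zero hk 0]
    have hint := integrableOn_sourceZero hu h hrate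
      (continuous_increment_zero_one u k).aestronglyMeasurable
      (continuous_increment_zero_two u k).aestronglyMeasurable
      (fun t ht => increment_zero_one u k ▸ abs_g_le h ht k)
      (fun t ht => increment_zero_two u k ▸ abs_deriv_g_le h ht k)
    exact continuousOn_const.add (continuousOn_intFromInfty hint)

theorem incrementBounds_increment_zero (hu : ContDiff ℝ 1 u) (h : IsThreshold u T) (k : Fin 3) :
    IncrementBounds T k 0 (increment u k 0) where
  meas
    | 0 => aestronglyMeasurable_of_continuousOn_Ici (continuousOn_increment_zero_zero hu h k)
    | 1 => (continuous_increment_zero_one u k).aestronglyMeasurable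
    | 2 => (continuous_increment_zero_two u k).aestronglyMeasurable
  one t ht := by
    rw [increment_zero_one]
    exact abs_g_le h ht k
  two t ht := by
    rw [increment_zero_two]
    exact abs_deriv_g_le h ht k
  zero t ht := abs_increment_zero_zero_le h k ht

end Initial

section Step

theorem abs_source_le_of_incrementBounds (h : IsThreshold u T) (hφ : IncrementBounds T k j φ)
    (ht : T ≤ t) : |source u φ t| ≤
      (2 / 3 * C₀ k j + 1 / 3 * boundOne k j) * expDecay (rate k j + 2 / 3) t :=
  hφ.abs_source_le h (by linarith) le_rfl ht

theorem abs_airyVariation_lt_of_incrementBounds (h : IsThreshold u T)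
    (hφ : IncrementBounds T k j φ) {x y : ℝ → ℝ} {w : ℝ} (ht : T ≤ t)
    (hx : |x (sc t)| < w * expDecay (2 / 9) t) (hy : |y (sc t)| < w * expDecay (-(2 / 9)) t) :
    2 * Real.pi / cbrtThree * |airyVariation x y u φ t| <
      w * (boundOne k (j + 1) * expDecay (rate k (j + 1) - 2 / 3) t) := by
  have hc : 0 < 2 / 3 * C₀ k j + 1 / 3 * boundOne k j := by
    linarith [C₀_pos k j, boundOne_nonneg k j]
  have hcbrt := cbrtThree_pos
  rw [rate_succ, add_sub_cancel_right, ← boundOne_succ_eq_of_source]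
  refine (mul_lt_mul_of_pos_left (abs_airyVariation_lt h hc (by linarith [rate_nonneg k j])
    (fun s hs => abs_source_le_of_incrementBounds h hφ hs) ht hx hy) (by positivity)).trans_eq ?_
  ring

theorem abs_picardOne_lt (h : IsThreshold u T) (hφ : IncrementBounds T k j φ) (ht : T ≤ t) :
    |picardOne u φ t| < boundOne k (j + 1) * expDecay (rate k (j + 1) - 2 / 3) t := by
  have hcbrt := cbrtThree_pos
  rw [picardOne, abs_mul, abs_of_pos (by positivity)]
  simpa only [one_mul] using abs_airyVariation_lt_of_incrementBounds h hφ (w := 1) ht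
    (by simpa only [one_mul] using h.abs_Ai_lt ht) (by simpa only [one_mul] using h.abs_Bi_lt ht)

theorem abs_picardTwo_lt (h : IsThreshold u T) (hφ : IncrementBounds T k j φ) (ht : T ≤ t) :
    |picardTwo u φ t| < boundOne k (j + 1) / 2 * (√t * expDecay (rate k (j + 1) - 2 / 3) t) := by
  have hlt := abs_airyVariation_lt_of_incrementBounds h hφ ht (h.abs_deriv_Ai_lt ht)
    (h.abs_deriv_Bi_lt ht)
  have hcbrt := cbrtThree_pos
  rw [picardTwo, abs_mul, abs_neg, abs_of_pos Real.pi_pos]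
  refine lt_of_mul_lt_mul_left ?_ (by positivity : 0 ≤ 2 / cbrtThree)
  calc 2 / cbrtThree * (Real.pi * |airyVariation (deriv Ai) (deriv Bi) u φ t|)
      = 2 * Real.pi / cbrtThree * |airyVariation (deriv Ai) (deriv Bi) u φ t| := by ring
    _ < √t / cbrtThree * (boundOne k (j + 1) * expDecay (rate k (j + 1) - 2 / 3) t) := hlt
    _ = 2 / cbrtThree *
        (boundOne k (j + 1) / 2 * (√t * expDecay (rate k (j + 1) - 2 / 3) t)) := by ring

theorem integrableOn_sourceZero_picard (hu : ContDiff ℝ 1 u) (h : IsThreshold u T)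
    (hφ : IncrementBounds T k j φ) :
    IntegrableOn (sourceZero u (picardOne u φ) (picardTwo u φ)) (Ioi T) := by
  have hconv := hφ.integralsConverge hu h
  have hrate : -(2 / 3) < rate k (j + 1) - 2 / 3 := by
    rw [rate_succ]
    linarith [rate_nonneg k j]
  exact integrableOn_sourceZero hu h hrate
    (aestronglyMeasurable_of_continuousOn_Ici (continuousOn_picardOne hconv))
    (aestronglyMeasurable_of_continuousOn_Ici (continuousOn_picardTwo hconv))
    (fun t ht => (abs_picardOne_lt h hφ ht).le) fun t ht => (abs_picardTwo_lt h hφ ht).le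

theorem abs_picard_zero_lt (hu : ContDiff ℝ 1 u) (h : IsThreshold u T)
    (hφ : IncrementBounds T k j φ) (ht : T ≤ t) :
    |picard u φ 0 t| < C₀ k (j + 1) * expDecay (rate k (j + 1)) t := by
  have hrate : 0 < rate k (j + 1) := by
    rw [rate_succ]
    linarith [rate_nonneg k j]
  rw [← boundOne_mul_div_rate hrate]
  refine abs_intFromInfty_lt hrate
    ((integrableOn_sourceZero_picard hu h hφ).mono_set (Ioi_subset_Ioi ht)) fun s hs => ?_
  simpa only [sub_add_cancel] using abs_sourceZero_lt h (ht.trans hs)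
    (abs_picardOne_lt h hφ (ht.trans hs)) (abs_picardTwo_lt h hφ (ht.trans hs))

theorem IncrementBounds.picard (hu : ContDiff ℝ 1 u) (h : IsThreshold u T)
    (hφ : IncrementBounds T k j φ) : IncrementBounds T k (j + 1) (picard u φ) where
  meas
    | 0 => aestronglyMeasurable_of_continuousOn_Ici
        (continuousOn_intFromInfty (integrableOn_sourceZero_picard hu h hφ))
    | 1 => aestronglyMeasurable_of_continuousOn_Ici
        (continuousOn_picardOne (hφ.integralsConverge hu h))
    | 2 => aestronglyMeasurable_of_continuousOn_Ici
        (continuousOn_picardTwo (hφ.integralsConverge hu h))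
  one _ ht := (abs_picardOne_lt h hφ ht).le
  two _ ht := (abs_picardTwo_lt h hφ ht).le
  zero _ ht := (abs_picard_zero_lt hu h hφ ht).le

theorem incrementBounds_increment (hu : ContDiff ℝ 1 u) (h : IsThreshold u T) (k : Fin 3) :
    ∀ j, IncrementBounds T k j (increment u k j)
  | 0 => incrementBounds_increment_zero hu h k
  | j + 1 => increment_succ u k j ▸ (incrementBounds_increment hu h k j).picard hu h

end Step

end Increments

section PartialSums

/-- The partial sums of the increments of the Picard iteration. They agree with the iterates
wherever the integrals of the increments converge absolutely. -/
def partialSum (u : ℝ → ℝ) (k : Fin 3) (j : ℕ) : Fin 3 → ℝ → ℝ :=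
  ∑ m ∈ Finset.range (j + 1), increment u k m

variable {u : ℝ → ℝ} {T t : ℝ} {k : Fin 3}

theorem increment_succ_one (u : ℝ → ℝ) (k : Fin 3) (j : ℕ) :
    increment u k (j + 1) 1 = picardOne u (increment u k j) := by
  rw [increment_succ]
  rfl

theorem increment_succ_two (u : ℝ → ℝ) (k : Fin 3) (j : ℕ) :
    increment u k (j + 1) 2 = picardTwo u (increment u k j) := by
  rw [increment_succ]
  rfl

theorem increment_succ_zero (u : ℝ → ℝ) (k : Fin 3) (j : ℕ) : increment u k (j + 1) 0 =
    intFromInfty (sourceZero u (increment u k (j + 1) 1) (increment u k (j + 1) 2)) := by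
  rw [increment_succ]
  rfl

theorem partialSum_apply (u : ℝ → ℝ) (k : Fin 3) (j : ℕ) (i : Fin 3) (t : ℝ) :
    partialSum u k j i t = ∑ m ∈ Finset.range (j + 1), increment u k m i t := by
  simp only [partialSum, Finset.sum_apply]

theorem partialSum_succ_one (hconv : ∀ j, IntegralsConverge u t (increment u k j)) (j : ℕ) :
    partialSum u k (j + 1) 1 t = g k t + picardOne u (partialSum u k j) t := by
  have hsum := picardOne_sum (F := Finset.range (j + 1)) 1 fun m _ => hconv m
  simp only [Pi.one_apply, one_smul, one_mul] at hsum
  rw [partialSum_apply, Finset.sum_range_succ', increment_zero_one, add_comm, partialSum, hsum]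
  simp only [increment_succ_one]

theorem partialSum_succ_two (hconv : ∀ j, IntegralsConverge u t (increment u k j)) (j : ℕ) :
    partialSum u k (j + 1) 2 t = -(3 / 2) * deriv (g k) t + picardTwo u (partialSum u k j) t := by
  have hsum := picardTwo_sum (F := Finset.range (j + 1)) 1 fun m _ => hconv m
  simp only [Pi.one_apply, one_smul, one_mul] at hsum
  rw [partialSum_apply, Finset.sum_range_succ', increment_zero_two, add_comm, partialSum, hsum]
  simp only [increment_succ_two]

theorem partialSum_zero (hconv : ∀ j, IntegralsConverge u t (increment u k j)) (j : ℕ) :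
    partialSum u k j 0 t =
      delta k + intFromInfty (sourceZero u (partialSum u k j 1) (partialSum u k j 2)) t := by
  have hsum := intFromInfty_sourceZero_sum (F := Finset.range (j + 1)) 1 fun m _ => hconv m
  simp only [Pi.one_apply, one_smul, one_mul] at hsum
  rw [partialSum_apply, partialSum, hsum, Finset.sum_range_succ', Finset.sum_range_succ',
    increment_zero_zero]
  simp only [← increment_succ_zero]
  ring

theorem iterate_succ_one (u : ℝ → ℝ) (k : Fin 3) (j : ℕ) (t : ℝ) :
    iterate u k (j + 1) 1 t = g k t + picardOne u (iterate u k j) t :=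
  rhsOne_eq u k _ t

theorem iterate_succ_two (u : ℝ → ℝ) (k : Fin 3) (j : ℕ) (t : ℝ) :
    iterate u k (j + 1) 2 t = -(3 / 2) * deriv (g k) t + picardTwo u (iterate u k j) t :=
  rhsTwo_eq u k _ t

theorem iterate_zero (u : ℝ → ℝ) (k : Fin 3) (j : ℕ) (t : ℝ) : iterate u k j 0 t =
    delta k + intFromInfty (sourceZero u (iterate u k j 1) (iterate u k j 2)) t := by
  cases j <;> rfl

theorem iterate_eq_partialSum (hconv : ∀ j, IntegralsConverge u T (increment u k j)) :
    ∀ (j : ℕ) (i : Fin 3) (t : ℝ), T ≤ t → iterate u k j i t = partialSum u k j i t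
  | 0, i, t, _ => by rw [partialSum_apply, Finset.sum_range_one]; rfl
  | j + 1, i, t, ht => by
    have hprev := iterate_eq_partialSum hconv j
    have hone (s) (hs : T ≤ s) : iterate u k (j + 1) 1 s = partialSum u k (j + 1) 1 s := by
      rw [iterate_succ_one, partialSum_succ_one (fun m => (hconv m).mono hs),
        picardOne_congr fun i r hr => hprev i r (hs.trans hr)]
    have htwo (s) (hs : T ≤ s) : iterate u k (j + 1) 2 s = partialSum u k (j + 1) 2 s := by
      rw [iterate_succ_two, partialSum_succ_two (fun m => (hconv m).mono hs),
        picardTwo_congr fun i r hr => hprev i r (hs.trans hr)]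
    match i with
    | 0 =>
      rw [iterate_zero, partialSum_zero fun m => (hconv m).mono ht,
        intFromInfty_sourceZero_congr (fun s hs => hone s (ht.trans hs))
          fun s hs => htwo s (ht.trans hs)]
    | 1 => exact hone t ht
    | 2 => exact htwo t ht

end PartialSums

section Limit

variable {u : ℝ → ℝ} {T t : ℝ}

theorem integralsConverge_increment (hu : ContDiff ℝ 1 u) (h : IsThreshold u T) (k : Fin 3)
    (j : ℕ) : IntegralsConverge u T (increment u k j) :=
  (incrementBounds_increment hu h k j).integralsConverge hu h

theorem iterate_succ_sub_iterate (hu : ContDiff ℝ 1 u) (h : IsThreshold u T) (k : Fin 3) (j : ℕ)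
    (i : Fin 3) (ht : T ≤ t) :
    iterate u k (j + 1) i t - iterate u k j i t = increment u k (j + 1) i t := by
  have hsum := iterate_eq_partialSum (integralsConverge_increment hu h k)
  rw [hsum _ _ _ ht, hsum _ _ _ ht, partialSum_apply, partialSum_apply, Finset.sum_range_succ,
    add_sub_cancel_left]

theorem differenceBounds (hu : ContDiff ℝ 1 u) (h : IsThreshold u T) (k : Fin 3) (j : ℕ)
    (ht : T ≤ t) : DifferenceBounds u k j t := by
  have hrate_sub : 4 / 3 * (j : ℝ) + 4 / 9 * ((k : ℕ) : ℝ) + 2 / 3 = rate k (j + 1) - 2 / 3 := by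
    rw [rate_succ, rate]
    ring
  have hrate : 4 / 3 * (j : ℝ) + 4 / 9 * ((k : ℕ) : ℝ) + 4 / 3 = rate k (j + 1) := by
    rw [rate_succ, rate]
    ring
  have hbounds := incrementBounds_increment hu h k j
  rw [DifferenceBounds, hrate_sub, hrate]
  simp only [iterate_succ_sub_iterate hu h k j _ ht, increment_succ, C₂, C₁_succ_eq_boundOne,
    mul_assoc]
  exact ⟨abs_picardOne_lt h hbounds ht, abs_picardTwo_lt h hbounds ht,
    abs_picard_zero_lt hu h hbounds ht⟩

theorem decayBounds_iterate (hu : ContDiff ℝ 1 u) (h : IsThreshold u T) (k : Fin 3) (j : ℕ) :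
    DecayBounds T (-(2 / 9)) 0 (∑' m, boundOne k m) (∑' m, C₀ k m) (iterate u k j) :=
  ((DecayBounds.sum fun m _ => (incrementBounds_increment hu h k m).decayBounds h).mono_const
    ((summable_boundOne k).sum_le_tsum (Finset.range (j + 1)) fun m _ => boundOne_nonneg k m)
    ((summable_C₀ k).sum_le_tsum _ fun m _ => (C₀_pos k m).le)).congr fun i t ht =>
      ((iterate_eq_partialSum (integralsConverge_increment hu h k) j i t ht).trans
        (partialSum_apply u k j i t)).symm

theorem integralsConverge_iterate (hu : ContDiff ℝ 1 u) (h : IsThreshold u T) (k : Fin 3) (j : ℕ) :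
    IntegralsConverge u T (iterate u k j) :=
  (decayBounds_iterate hu h k j).integralsConverge hu h (by norm_num) (by norm_num)

/-- The limit `(Φ_{1k}, Φ_{2k}, Φ_{0k})` of the Picard iteration, as the sum of its increments. -/
def picardLimit (u : ℝ → ℝ) (k : Fin 3) : Fin 3 → ℝ → ℝ := fun i t => ∑' m, increment u k m i t

theorem summable_increment (hu : ContDiff ℝ 1 u) (h : IsThreshold u T) (k : Fin 3) (ht : T ≤ t) :
    ∀ i, Summable fun m => increment u k m i t
  | 0 => .of_norm_bounded ((summable_C₀ k).mul_right _) fun m =>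
    ((incrementBounds_increment hu h k m).decayBounds h).zero t ht
  | 1 => .of_norm_bounded ((summable_boundOne k).mul_right _) fun m =>
    ((incrementBounds_increment hu h k m).decayBounds h).one t ht
  | 2 => .of_norm_bounded (((summable_boundOne k).div_const 2).mul_right _) fun m =>
    ((incrementBounds_increment hu h k m).decayBounds h).two t ht

theorem tendsto_iterate (hu : ContDiff ℝ 1 u) (h : IsThreshold u T) (k i : Fin 3) (ht : T ≤ t) :
    Tendsto (fun j => iterate u k j i t) atTop (𝓝 (picardLimit u k i t)) := by
  refine (((summable_increment hu h k ht i).hasSum.tendsto_sum_nat).comp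
    (tendsto_add_atTop_nat 1)).congr fun j => ?_
  rw [iterate_eq_partialSum (integralsConverge_increment hu h k) j i t ht, partialSum_apply]
  rfl

theorem integralsConverge_picardLimit (hu : ContDiff ℝ 1 u) (h : IsThreshold u T) (k : Fin 3) :
    IntegralsConverge u T (picardLimit u k) :=
  (DecayBounds.of_tendsto (decayBounds_iterate hu h k)
    fun i _ ht => tendsto_iterate hu h k i ht).integralsConverge hu h (by norm_num) (by norm_num)

theorem solvesIntegralEquations_picardLimit (hu : ContDiff ℝ 1 u) (h : IsThreshold u T)
    (k : Fin 3) : SolvesIntegralEquations u T k (picardLimit u k) := by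
  refine ⟨integralsConverge_picardLimit hu h k, fun t ht => ?_⟩
  have hlim i s (hs : T ≤ s) := tendsto_iterate hu h k i hs
  have hvar (x y : ℝ → ℝ) := tendsto_airyVariation x y hu.continuous h (by norm_num) (by norm_num)
    (decayBounds_iterate hu h k) hlim ht
  have hone := (hlim 1 t ht).comp (tendsto_add_atTop_nat 1)
  have htwo := (hlim 2 t ht).comp (tendsto_add_atTop_nat 1)
  refine ⟨tendsto_nhds_unique hone ?_, tendsto_nhds_unique htwo ?_,
    tendsto_nhds_unique (hlim 0 t ht) ?_⟩
  · rw [rhsOne_eq]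
    exact ((hvar Ai Bi).const_mul _).const_add _
  · rw [rhsTwo_eq]
    exact (((hvar (deriv Ai) (deriv Bi)).const_mul _).const_add _).congr fun j =>
      (iterate_succ_two u k j t).symm
  · exact ((tendsto_intFromInfty_sourceZero hu h (by norm_num) (decayBounds_iterate hu h k)
      hlim ht).const_add _).congr fun j => (iterate_zero u k j t).symm

end Limit

section Solutions

variable {u : ℝ → ℝ} {T t : ℝ} {k : Fin 3} {φ : Fin 3 → ℝ → ℝ}

theorem SolvesIntegralEquations.one_eq (hφ : SolvesIntegralEquations u T k φ) (ht : T ≤ t) :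
    φ 1 t = g k t + picardOne u φ t :=
  (hφ.2 t ht).1

theorem SolvesIntegralEquations.two_eq (hφ : SolvesIntegralEquations u T k φ) (ht : T ≤ t) :
    φ 2 t = -(3 / 2) * deriv (g k) t + picardTwo u φ t :=
  (hφ.2 t ht).2.1.trans (rhsTwo_eq u k φ t)

theorem SolvesIntegralEquations.zero_eq (hφ : SolvesIntegralEquations u T k φ) (ht : T ≤ t) :
    φ 0 t = delta k + intFromInfty (sourceZero u (φ 1) (φ 2)) t :=
  (hφ.2 t ht).2.2

theorem SolvesIntegralEquations.continuousOn (hφ : SolvesIntegralEquations u T k φ) :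
    ∀ i, ContinuousOn (φ i) (Ici T)
  | 0 => (continuousOn_const.add (continuousOn_intFromInfty hφ.1.2.2)).congr
      fun _ ht => hφ.zero_eq ht
  | 1 => ((continuous_g k).continuousOn.add (continuousOn_picardOne hφ.1)).congr
      fun _ ht => hφ.one_eq ht
  | 2 => ((continuousOn_const.mul (continuous_deriv_g k).continuousOn).add
      (continuousOn_picardTwo hφ.1)).congr fun _ ht => hφ.two_eq ht

theorem SolvesIntegralEquations.continuousOn_source (hφ : SolvesIntegralEquations u T k φ)
    (hu : Continuous u) : ContinuousOn (source u φ) (Ici T) :=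
  ((continuous_const.mul hu).continuousOn.mul (hφ.continuousOn 0)).sub
    ((continuous_const.mul (hu.pow 2)).continuousOn.mul (hφ.continuousOn 1))

theorem SolvesIntegralEquations.continuousOn_sourceZero (hφ : SolvesIntegralEquations u T k φ)
    (hu : ContDiff ℝ 1 u) : ContinuousOn (sourceZero u (φ 1) (φ 2)) (Ici T) :=
  ((continuous_const.mul (hu.continuous_deriv le_rfl)).continuousOn.mul (hφ.continuousOn 1)).sub
    ((continuous_const.mul hu.continuous).continuousOn.mul (hφ.continuousOn 2))

theorem SolvesIntegralEquations.hasDerivWithinAt_one (hφ : SolvesIntegralEquations u T k φ)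
    (hu : Continuous u) (ht : T ≤ t) :
    HasDerivWithinAt (φ 1) (-(2 / 3) * φ 2 t) (Ici T) t := by
  convert! ((hasDerivAt_g k t).hasDerivWithinAt.add
    (hasDerivWithinAt_picardOne hφ.1 (hφ.continuousOn_source hu) ht)).congr
    (fun s hs => hφ.one_eq hs) (hφ.one_eq ht) using 1
  rw [hφ.two_eq ht]
  ring

theorem SolvesIntegralEquations.hasDerivWithinAt_two (hφ : SolvesIntegralEquations u T k φ)
    (hu : Continuous u) (ht : T ≤ t) : HasDerivWithinAt (φ 2)
      (-(2 / 3) * u t * φ 0 t - 1 / 6 * (t + 2 * u t ^ 2) * φ 1 t) (Ici T) t := by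
  convert! (((hasDerivAt_deriv_g k t).const_mul (-(3 / 2))).hasDerivWithinAt.add
    (hasDerivWithinAt_picardTwo hφ.1 (hφ.continuousOn_source hu) ht)).congr
    (fun s hs => hφ.two_eq hs) (hφ.two_eq ht) using 1
  rw [source]
  linear_combination -(t / 6) * hφ.one_eq ht

theorem SolvesIntegralEquations.isSolutionOn (hφ : SolvesIntegralEquations u T k φ)
    (hu : ContDiff ℝ 1 u) : IsSolutionOn u T φ := fun _ ht =>
  ⟨hφ.hasDerivWithinAt_one hu.continuous ht, hφ.hasDerivWithinAt_two hu.continuous ht,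
    ((hasDerivWithinAt_intFromInfty hφ.1.2.2 (hφ.continuousOn_sourceZero hu) ht).const_add
      (delta k)).congr (fun _ hs => hφ.zero_eq hs) (hφ.zero_eq ht)⟩

end Solutions

section LinearIndependence

variable {u : ℝ → ℝ} {T t : ℝ} {c : Fin 3 → ℝ}

theorem eq_zero_of_sum_mul_g_eq_zero (hg : ∑ k, c k * g k t = 0)
    (hg' : ∑ k, c k * deriv (g k) t = 0) : c 1 = 0 ∧ c 2 = 0 := by
  have hw : Ai (sc t) * deriv Bi (sc t) - deriv Ai (sc t) * Bi (sc t) ≠ 0 := by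
    rw [wronskian]
    exact inv_ne_zero Real.pi_ne_zero
  have hcbrt := cbrtThree_pos
  have hval : c 1 * Bi (sc t) + c 2 * Ai (sc t) = 0 := by
    simpa [Fin.sum_univ_three, g] using hg
  have hder : c 1 * deriv Bi (sc t) + c 2 * deriv Ai (sc t) = 0 := by
    rw [Fin.sum_univ_three, (hasDerivAt_g_zero t).deriv, (hasDerivAt_g_one t).deriv,
      (hasDerivAt_g_two t).deriv] at hg'
    field_simp at hg'
    linear_combination hg'
  constructor <;> refine (mul_eq_zero.1 ?_).resolve_right hw
  · linear_combination Ai (sc t) * hder - deriv Ai (sc t) * hval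
  · linear_combination deriv Bi (sc t) * hval - Bi (sc t) * hder

theorem eq_zero_of_sum_mul_solution_eq_zero {Φ : Fin 3 → Fin 3 → ℝ → ℝ}
    (hΦ : ∀ k, SolvesIntegralEquations u T k (Φ k))
    (hsum : ∀ i t, T ≤ t → ∑ k, c k * Φ k i t = 0) : c = 0 := by
  have hconv : ∀ k ∈ Finset.univ, IntegralsConverge u T (Φ k) := fun k _ => (hΦ k).1
  have hcomb : ∀ i t, T ≤ t → (∑ k, c k • Φ k) i t = (0 : Fin 3 → ℝ → ℝ) i t := fun i t ht => by
    simpa only [Finset.sum_apply, Pi.smul_apply, smul_eq_mul, Pi.zero_apply] using hsum i t ht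
  have hone : ∑ k, c k * picardOne u (Φ k) T = 0 := by
    rw [← picardOne_sum c hconv, picardOne_congr hcomb, picardOne_zero]
  have htwo : ∑ k, c k * picardTwo u (Φ k) T = 0 := by
    rw [← picardTwo_sum c hconv, picardTwo_congr hcomb, picardTwo_zero]
  have hzero : ∑ k, c k * intFromInfty (sourceZero u (Φ k 1) (Φ k 2)) T = 0 := by
    rw [← intFromInfty_sourceZero_sum c hconv, intFromInfty_sourceZero_congr (hcomb 1) (hcomb 2)]
    exact intFromInfty_sourceZero_zero u T
  have hsum_one := hsum 1 T le_rfl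
  have hsum_two := hsum 2 T le_rfl
  have hsum_zero := hsum 0 T le_rfl
  simp only [(hΦ _).one_eq le_rfl, mul_add, Finset.sum_add_distrib, hone, add_zero] at hsum_one
  simp only [(hΦ _).two_eq le_rfl, mul_add, Finset.sum_add_distrib, htwo, add_zero,
    mul_left_comm (c _), ← Finset.mul_sum] at hsum_two
  simp only [(hΦ _).zero_eq le_rfl, mul_add, Finset.sum_add_distrib, hzero, add_zero] at hsum_zero
  obtain ⟨h₁, h₂⟩ := eq_zero_of_sum_mul_g_eq_zero hsum_one
    ((mul_eq_zero.1 hsum_two).resolve_left (by norm_num))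
  have h₀ : c 0 = 0 := by simpa [delta] using hsum_zero
  funext k
  fin_cases k <;> assumption

end LinearIndependence

end

end AiryPicard

theorem mainTheorem4_general {u : ℝ → ℝ} (hu : ContDiff ℝ 1 u) {T : ℝ} (h : IsThreshold u T) :
    (∀ (k : Fin 3) (j : ℕ), IntegralsConverge u T (AiryPicard.iterate u k j)) ∧
    (∀ (k : Fin 3) (j : ℕ) (t : ℝ), T ≤ t → DifferenceBounds u k j t) ∧
    ∃ Φ : Fin 3 → Fin 3 → ℝ → ℝ,
      (∀ (k i : Fin 3) (t : ℝ), T ≤ t →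
        Tendsto (fun j : ℕ => AiryPicard.iterate u k j i t) atTop (𝓝 (Φ k i t))) ∧
      (∀ k : Fin 3, SolvesIntegralEquations u T k (Φ k)) ∧
      (∀ k : Fin 3, IsSolutionOn u T (Φ k)) ∧
      (∀ c : Fin 3 → ℝ,
        (∀ (i : Fin 3) (t : ℝ), T ≤ t → ∑ k, c k * Φ k i t = 0) → c = 0) :=
  have hsolves := solvesIntegralEquations_picardLimit hu h
  ⟨integralsConverge_iterate hu h, fun k j _ ht => differenceBounds hu h k j ht, picardLimit u,
    fun k i _ ht => tendsto_iterate hu h k i ht, hsolves, fun k => (hsolves k).isSolutionOn hu,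
    fun _ hc => eq_zero_of_sum_mul_solution_eq_zero hsolves hc⟩

theorem mainTheorem4 (u : ℝ → ℝ) (hu : IsHastingsMcLeod u) :
    (∃ T : ℝ, IsThreshold u T) ∧
    ∀ T : ℝ, IsThreshold u T →
      (∀ (k : Fin 3) (j : ℕ), IntegralsConverge u T (AiryPicard.iterate u k j)) ∧
      (∀ (k : Fin 3) (j : ℕ) (t : ℝ), T ≤ t → DifferenceBounds u k j t) ∧
      ∃ Φ : Fin 3 → Fin 3 → ℝ → ℝ,
        (∀ (k i : Fin 3) (t : ℝ), T ≤ t →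
          Tendsto (fun j : ℕ => AiryPicard.iterate u k j i t) atTop (𝓝 (Φ k i t))) ∧
        (∀ k : Fin 3, SolvesIntegralEquations u T k (Φ k)) ∧
        (∀ k : Fin 3, IsSolutionOn u T (Φ k)) ∧
        (∀ c : Fin 3 → ℝ,
          (∀ (i : Fin 3) (t : ℝ), T ≤ t → ∑ k, c k * Φ k i t = 0) → c = 0) :=
  ⟨exists_isThreshold hu, fun _ h => mainTheorem4_general hu.contDiff h⟩
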